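/- Let $\alpha:\mathbb R\to\mathbb R$ satisfy (C1) $\alpha\in W^{2,1}(\mathbb R)$, and (C2) the distributional derivative $\alpha'''=\mu$ is a finite signed Borel measure on $\mathbb R$; here $\alpha'$ denotes the continuous representative of the weak derivative of $\alpha$. Let $\kappa>0$, $s>9/2$, let $f\in C^{[s]+1}(\mathbb R)$ be real-valued with $f(0)=0$ ($[s]$ is the integer part of $s$), let $T>0$, and let $\varphi\in H^s(\mathbb R)$ be real-valued. Let $u\in C^1([0,T],H^s(\mathbb R))$ be the solution of $$u_t+\alpha'*f(u)+\kappa\,\alpha'''*u=0,\qquad u(\cdot,0)=\varphi ,$$ where $(\alpha'*f(u))(x)=\int_{\mathbb R}\alpha'(x-y)f(u(y))\,dy$ and $(\alpha'''*u)(x)=\int_{\mathbb R}u(x-y)\,d\mu(y)$. (Elements of $H^s(\mathbb R)$ are identified with their continuous representatives.) For $h>0$ write $x_i=ih$ $(i\in\mathbb Z)$, $\boldsymbol\alpha'_h=(\alpha'(x_i))_{i}$, $\boldsymbol\varphi_h=(\varphi(x_i))_i$, $(\mathbf w*\mathbf v)_i=\sum_{j\in\mathbb Z}h\,w_{i-j}v_j$,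 $(D_h^2\mathbf w)_i=h^{-2}(w_{i+1}-2w_i+w_{i-1})$, and $f(\mathbf v)=(f(v_i))_i$. Consider the $\ell^\infty(\mathbb Z)$-valued semi-discrete problem $$\frac{d\mathbf v}{dt}=-\boldsymbol\alpha'_h*f(\mathbf v)-\kappa\,(D_h^2\boldsymbol\alpha'_h)*\mathbf v,\qquad \mathbf v(0)=\boldsymbol\varphi_h .\tag{3.1}$$ Then there are $h_0>0$ and a constant $C$ such that for every $h$ with $0<h\le h_0$ the following holds: the problem (3.1) has a maximal solution $\mathbf u_h\in C^1([0,T_h),\ell^\infty(\mathbb Z))$ with $0<T_h\le\infty$, and for every such maximal solution $T_h>T$ and $$\sup_{i\in\mathbb Z}\bigl|u(x_i,t)-(\mathbf u_h)_i(t)\bigr|\le C\,h^2\qquad\text{for all } t\in[0,T].$$ The constant $C$ does not depend on $h$ or $t$. -/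

import Mathlib

open MeasureTheory Set
open scoped ENNReal ContDiff SchwartzMap

noncomputable section

namespace NonlocalKdV

/-! ### Weak derivatives, `W^{k,p}(ℝ)`, continuous representatives -/

/-- A real test function on the line: smooth with compact support. -/
def IsTestFunction (φ : ℝ → ℝ) : Prop :=
  ContDiff ℝ ∞ φ ∧ HasCompactSupport φ

/-- `v` is the weak derivative of `u` on the line. -/
def IsWeakDeriv (u v : ℝ → ℝ) : Prop :=
  LocallyIntegrable u ∧ LocallyIntegrable v ∧
    ∀ φ : ℝ → ℝ, IsTestFunction φ → ∫ x, u x * deriv φ x = -∫ x, v x * φ x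

/-- Membership in `W^{k,p}(ℝ)`: `u` and its weak derivatives of order at most `k` are in `L^p`. -/
def MemW : ℕ → ℝ≥0∞ → (ℝ → ℝ) → Prop
  | 0, p, u => MemLp u p
  | k + 1, p, u => MemLp u p ∧ ∃ v : ℝ → ℝ, IsWeakDeriv u v ∧ MemW k p v

/-- The signed measure `μ` (finite, as every signed measure) is the third distributional
derivative of `α`. -/
def IsThirdDerivMeasure (α : ℝ → ℝ) (μ : SignedMeasure ℝ) : Prop :=
  ∀ φ : ℝ → ℝ, IsTestFunction φ →
    ∫ x, α x * iteratedDeriv 3 φ x = -∫ᵛ x, φ x ∂•μ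

open Classical in
/-- The weak derivative of `u`, determined almost everywhere (and `0` if there is none). -/
def weakDeriv (u : ℝ → ℝ) : ℝ → ℝ :=
  if h : ∃ v : ℝ → ℝ, IsWeakDeriv u v then h.choose else 0

open Classical in
/-- The continuous representative of the almost-everywhere class of `g`
(it is unique; if there is none, `g` itself is returned). -/
def contRep (g : ℝ → ℝ) : ℝ → ℝ :=
  if h : ∃ c : ℝ → ℝ, Continuous c ∧ c =ᵐ[volume] g then h.choose else g

/-- The derivative `α'` of a kernel, as a continuous function. For `α ∈ W^{2,1}(ℝ)` the weak
derivative is in `W^{1,1}(ℝ)`, so that it does have a continuous representative. -/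
def kernelDeriv (α : ℝ → ℝ) : ℝ → ℝ :=
  contRep (weakDeriv α)

/-! ### The real Sobolev space `H^s(ℝ)`, `s ≥ 0`, as a normed space -/

/-- A real `L²` function regarded as a complex one. -/
def complexify : Lp ℝ 2 (volume : Measure ℝ) →L[ℝ] Lp ℂ 2 (volume : Measure ℝ) :=
  Complex.ofRealCLM.compLpL 2 volume

/-- The real `L²` functions that belong to `H^s(ℝ)`. -/
def sobolevSubmodule (s : ℝ) : Submodule ℝ (Lp ℝ 2 (volume : Measure ℝ)) where
  carrier := {g | TemperedDistribution.MemSobolev s 2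
    (Lp.toTemperedDistributionCLM ℂ volume 2 (complexify g))}
  add_mem' {a b} ha hb := by
    change TemperedDistribution.MemSobolev s 2
      (Lp.toTemperedDistributionCLM ℂ volume 2 (complexify (a + b)))
    rw [map_add, map_add]
    exact TemperedDistribution.MemSobolev.add ha hb
  zero_mem' := by
    change TemperedDistribution.MemSobolev s 2
      (Lp.toTemperedDistributionCLM ℂ volume 2 (complexify 0))
    rw [map_zero, map_zero]
    exact TemperedDistribution.memSobolev_fun_zero ℝ ℂ s 2
  smul_mem' c x hx := by
    change TemperedDistribution.MemSobolev s 2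
      (Lp.toTemperedDistributionCLM ℂ volume 2 (complexify (c • x)))
    have h : complexify (c • x) = (c : ℂ) • complexify x := by
      rw [map_smul]; exact (Complex.coe_smul c _).symm
    rw [h, map_smul]
    exact TemperedDistribution.MemSobolev.smul _ hx

/-- The real Sobolev space `H^s(ℝ)` for `s ≥ 0`. Its norm is not the `L²` norm but the one
defined below. -/
def Sobolev (s : ℝ) : Type := sobolevSubmodule s

instance (s : ℝ) : AddCommGroup (Sobolev s) := inferInstanceAs (AddCommGroup (sobolevSubmodule s))
instance (s : ℝ) : Module ℝ (Sobolev s) := inferInstanceAs (Module ℝ (sobolevSubmodule s))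

/-- The inclusion of `H^s(ℝ)` in `L²(ℝ)`. -/
def Sobolev.toL2 (s : ℝ) : Sobolev s →ₗ[ℝ] Lp ℝ 2 (volume : Measure ℝ) :=
  (sobolevSubmodule s).subtype

theorem toTempered_injective {f g : Lp ℂ 2 (volume : Measure ℝ)}
    (h : Lp.toTemperedDistributionCLM ℂ volume 2 f = Lp.toTemperedDistributionCLM ℂ volume 2 g) :
    f = g :=
  LinearMap.ker_eq_bot.mp
    (Lp.ker_toTemperedDistributionCLM_eq_bot (E := ℝ) (F := ℂ) (μ := volume) (p := 2)) h

theorem complexify_injective {f g : Lp ℝ 2 (volume : Measure ℝ)}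
    (h : complexify f = complexify g) : f = g := by
  have hf := Complex.ofRealCLM.coeFn_compLpL (p := 2) (μ := (volume : Measure ℝ)) f
  have hg := Complex.ofRealCLM.coeFn_compLpL (p := 2) (μ := (volume : Measure ℝ)) g
  have h' : (complexify f : ℝ → ℂ) =ᵐ[volume] complexify g := by rw [h]
  apply Lp.ext
  filter_upwards [hf, hg, h'] with x h1 h2 h3
  have : (f x : ℂ) = (g x : ℂ) := by
    rw [show (f x : ℂ) = Complex.ofRealCLM (f x) from rfl, ← h1,
      show (g x : ℂ) = Complex.ofRealCLM (g x) from rfl, ← h2]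
    exact h3
  exact_mod_cast this

theorem Sobolev.exists_bessel {s : ℝ} (g : Sobolev s) :
    ∃ b : Lp ℂ 2 (volume : Measure ℝ), TemperedDistribution.besselPotential ℝ ℂ s
        (Lp.toTemperedDistributionCLM ℂ volume 2 (complexify (Sobolev.toL2 s g))) =
      Lp.toTemperedDistributionCLM ℂ volume 2 b := g.2

/-- The Bessel potential `g ↦ 𝓕⁻¹ ((1 + |ξ|²)^{s/2} 𝓕 g)` of an element of `H^s(ℝ)`, as an element
of `L²(ℝ)`. -/
def Sobolev.bessel (s : ℝ) : Sobolev s →ₗ[ℝ] Lp ℂ 2 (volume : Measure ℝ) where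
  toFun g := (Sobolev.exists_bessel g).choose
  map_add' a b := by
    apply toTempered_injective
    have e1 := (Sobolev.exists_bessel a).choose_spec
    have e2 := (Sobolev.exists_bessel b).choose_spec
    refine (Sobolev.exists_bessel (a + b)).choose_spec.symm.trans ?_
    rw [map_add, map_add, map_add, map_add, map_add]
    exact congrArg₂ (· + ·) e1 e2
  map_smul' c a := by
    apply toTempered_injective
    have e1 := (Sobolev.exists_bessel a).choose_spec
    have hc : ∀ y : Lp ℂ 2 (volume : Measure ℝ), c • y = (c : ℂ) • y :=
      fun y => (Complex.coe_smul c y).symm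
    refine (Sobolev.exists_bessel (c • a)).choose_spec.symm.trans ?_
    rw [RingHom.id_apply, map_smul, map_smul, hc, hc, map_smul, map_smul, map_smul]
    exact congrArg ((c : ℂ) • ·) e1

theorem Sobolev.bessel_spec (s : ℝ) (g : Sobolev s) :
    TemperedDistribution.besselPotential ℝ ℂ s
        (Lp.toTemperedDistributionCLM ℂ volume 2 (complexify (Sobolev.toL2 s g))) =
      Lp.toTemperedDistributionCLM ℂ volume 2 (Sobolev.bessel s g) :=
  (Sobolev.exists_bessel g).choose_spec

theorem Sobolev.bessel_injective (s : ℝ) : Function.Injective (Sobolev.bessel s) := by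
  intro a b hab
  have h := (Sobolev.bessel_spec s a).trans
    ((congrArg _ hab).trans (Sobolev.bessel_spec s b).symm)
  have h' := congrArg (TemperedDistribution.besselPotential ℝ ℂ (-s)) h
  simp only [TemperedDistribution.besselPotential_besselPotential_apply, add_neg_cancel,
    TemperedDistribution.besselPotential_zero, ContinuousLinearMap.id_apply] at h'
  exact Subtype.ext (complexify_injective (toTempered_injective h'))

/-- The `H^s` norm is the `L²` norm of the Bessel potential of order `s`. -/
instance (s : ℝ) : NormedAddCommGroup (Sobolev s) :=
  NormedAddCommGroup.induced (Sobolev s) (Lp ℂ 2 (volume : Measure ℝ)) (Sobolev.bessel s)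
    (Sobolev.bessel_injective s)

instance (s : ℝ) : NormedSpace ℝ (Sobolev s) :=
  NormedSpace.induced ℝ (Sobolev s) (Lp ℂ 2 (volume : Measure ℝ)) (Sobolev.bessel s)

theorem Sobolev.norm_def {s : ℝ} (g : Sobolev s) : ‖g‖ = ‖Sobolev.bessel s g‖ := rfl

/-- An element of `H^s(ℝ)`, `s > 1/2`, as a function on the line: its continuous representative. -/
def Sobolev.fn {s : ℝ} (g : Sobolev s) : ℝ → ℝ :=
  contRep (Sobolev.toL2 s g : ℝ → ℝ)

/-! ### The continuous Cauchy problem -/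

/-- `u ∈ C¹([0,T], H^s(ℝ))` solves `u_t + α' ∗ f(u) + κ α''' ∗ u = 0`, `u(0) = φ`, where
`α''' = μ` is a measure, so that `(α''' ∗ u)(x) = ∫ u(x - y) dμ(y)`. -/
structure IsCauchySolution (α : ℝ → ℝ) (μ : SignedMeasure ℝ) (f : ℝ → ℝ) (κ : ℝ) {s : ℝ}
    (φ : Sobolev s) (T : ℝ) (u : ℝ → Sobolev s) : Prop where
  contDiffOn : ContDiffOn ℝ 1 u (Icc 0 T)
  initial : u 0 = φ
  equation : ∀ t ∈ Icc 0 T, ∀ᵐ x : ℝ,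
    (derivWithin u (Icc 0 T) t).fn x + (∫ y, kernelDeriv α (x - y) * f ((u t).fn y))
      + κ * (∫ᵛ y, (u t).fn (x - y) ∂•μ) = 0

/-! ### The semi-discrete problem -/

/-- The restriction `(w(ih))_i` of a function to the grid of mesh size `h`. -/
def gridRestrict (h : ℝ) (w : ℝ → ℝ) : ℤ → ℝ := fun i => w (i * h)

/-- The discrete convolution `(w ∗ v)_i = ∑_j h w_{i-j} v_j`. -/
def discreteConv (h : ℝ) (w v : ℤ → ℝ) : ℤ → ℝ := fun i => ∑' j : ℤ, h * w (i - j) * v j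

/-- The second-order difference operator `(D_h² w)_i = (w_{i+1} - 2 w_i + w_{i-1}) / h²`. -/
def secondDiff (h : ℝ) (w : ℤ → ℝ) : ℤ → ℝ :=
  fun i => 1 / h ^ 2 * (w (i + 1) - 2 * w i + w (i - 1))

/-- The real time interval `[0, S)`, where `S` may be infinite. -/
def timeInterval (S : EReal) : Set ℝ := {t | 0 ≤ t ∧ (t : EReal) < S}

/-- `v ∈ C¹([0,S), ℓ^∞)` solves `dv/dt = -α'_h ∗ f(v) - κ D_h² α'_h ∗ v` with `v(0) = v₀`,
where `α'_h = (α'(ih))_i`. -/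
structure IsSemidiscreteSolution (α f : ℝ → ℝ) (κ h : ℝ) (v₀ : ℤ → ℝ) (S : EReal)
    (v : ℝ → lp (fun _ : ℤ => ℝ) ∞) : Prop where
  contDiffOn : ContDiffOn ℝ 1 v (timeInterval S)
  initial : ∀ i : ℤ, v 0 i = v₀ i
  equation : ∀ t ∈ timeInterval S, ∀ i : ℤ,
    derivWithin v (timeInterval S) t i =
      - discreteConv h (gridRestrict h (kernelDeriv α)) (fun j => f (v t j)) i
      - κ * discreteConv h (secondDiff h (gridRestrict h (kernelDeriv α))) (fun j => v t j) i

/-- `v` is a solution on `[0,S)`, `S > 0`, that is not the restriction of a solution on a longer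
interval: `S` is its maximal existence time. -/
structure IsMaximalSemidiscreteSolution (α f : ℝ → ℝ) (κ h : ℝ) (v₀ : ℤ → ℝ) (S : EReal)
    (v : ℝ → lp (fun _ : ℤ => ℝ) ∞) : Prop where
  pos : 0 < S
  solution : IsSemidiscreteSolution α f κ h v₀ S v
  maximal : ∀ (S' : EReal) (w : ℝ → lp (fun _ : ℤ => ℝ) ∞), S < S' →
    IsSemidiscreteSolution α f κ h v₀ S' w → ¬ EqOn v w (timeInterval S)

end NonlocalKdV

end

namespace NonlocalKdV

/-! ### Hat functions and piecewise linear interpolation -/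

/-! The proof is consistency plus stability, and both rest on hat functions. The second derivative
of the hat of width `h` is `δ_{-h} - 2 δ_0 + δ_h`. Since the second distributional derivative of `a
= kernelDeriv α` is `μ`, the second difference of `a` at `x` is exactly the integral of `hat h (y -
x)` against `μ` (`secondDiff_eq_integral_hat`). The translates of the hat along the grid sum to `h`.

Consistency. By these two facts, discrete convolution with `D_h² α'` is integration against `μ` of
the piecewise linear interpolant of the other factor. If that factor has a quadratic Taylor bound,
the error is `O(h²)` times the total variation of `μ`, however singular `μ` is. In the other
convolution, `h a(kh)` is compared with the hat average of `a` near `kh`. They differ by at most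
`h/2` times a local mass of `|μ|`, and these masses sum to `O(h)`, so the same interpolation
estimate finishes (`SecondDiffBound.abs_trapezoid_le`). The Taylor bound for `u(t)` comes from
Sobolev embedding: for `s > 5/2` the Fourier transform is integrable against `1 + ξ²`. It is uniform
on the compact interval `[0,T]` and passes to `f(u)` for `f` of class `C²`. Restriction to the grid
is a bounded operator from `H^s` to `ℓ^∞`, so the restricted solution is a differentiable curve with
defect `O(h²)`.

Stability. The same local masses bound the `ℓ¹` norms of both discrete kernels uniformly for `h ≤
1`, so the vector field is Lipschitz on balls with a constant free of `h`. Truncating outside a ball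
gives a solution beyond `T`. Gronwall keeps it within `O(h²)` of the restricted `u`, hence inside
the ball for small `h`, where truncation does nothing (`exists_solvesODE_of_approx`). Uniqueness
carries existence past `T` and the estimate over to every maximal solution. -/

/-- The hat function of width `h` and height `h`. -/
def hat (h z : ℝ) : ℝ := max 0 (h - |z|)

theorem hat_nonneg (h z : ℝ) : 0 ≤ hat h z := le_max_left _ _

theorem hat_le {h : ℝ} (hh : 0 ≤ h) (z : ℝ) : hat h z ≤ h :=
  max_le hh (by linarith [abs_nonneg z])

theorem hat_mono {t h : ℝ} (hth : t ≤ h) (z : ℝ) : hat t z ≤ hat h z :=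
  max_le_max le_rfl (by linarith)

theorem hat_neg (h z : ℝ) : hat h (-z) = hat h z := by simp [hat]

theorem hat_eq_zero {h z : ℝ} (hz : h ≤ |z|) : hat h z = 0 := max_eq_left (by linarith)

@[fun_prop]
theorem continuous_hat (h : ℝ) : Continuous (hat h) := by unfold hat; fun_prop

/-- As a second difference of the positive part, the hat can be smoothed by smoothing the positive
part alone. -/
theorem hat_eq_posPart (h z : ℝ) (hh : 0 ≤ h) :
    hat h z = max 0 (z + h) - 2 * max 0 z + max 0 (z - h) := by
  unfold hat
  rcases abs_cases z with ⟨h1, h2⟩ | ⟨h1, h2⟩ <;> rw [h1] <;>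
  rcases max_cases 0 (h - z) with ⟨h3, h4⟩ | ⟨h3, h4⟩ <;>
  rcases max_cases 0 (h - -z) with ⟨h5, h6⟩ | ⟨h5, h6⟩ <;>
  rcases max_cases 0 (z + h) with ⟨h7, h8⟩ | ⟨h7, h8⟩ <;>
  rcases max_cases 0 z with ⟨h9, h10⟩ | ⟨h9, h10⟩ <;>
  rcases max_cases 0 (z - h) with ⟨h11, h12⟩ | ⟨h11, h12⟩ <;> linarith

/-- Only two hat functions of the grid are nonzero at a given point. -/
theorem exists_hasSum_hat_mul {h : ℝ} (hh : 0 < h) (y : ℝ) :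
    ∃ (n : ℤ) (r : ℝ), y = n * h + r ∧ 0 ≤ r ∧ r < h ∧ ∀ w : ℤ → ℝ,
      HasSum (fun k : ℤ => hat h (y - k * h) * w k) ((h - r) * w n + r * w (n + 1)) := by
  refine ⟨⌊y / h⌋, y - ⌊y / h⌋ * h, by ring, ?_, ?_, fun w => ?_⟩
  · have := (le_div_iff₀ hh).1 (Int.floor_le (y / h)); linarith
  · have := (div_lt_iff₀ hh).1 (Int.lt_floor_add_one (y / h)); linarith
  set n := ⌊y / h⌋
  have h1 : (n : ℝ) * h ≤ y := (le_div_iff₀ hh).1 (Int.floor_le (y / h))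
  have h2 : y < (n + 1 : ℝ) * h := (div_lt_iff₀ hh).1 (Int.lt_floor_add_one (y / h))
  have e1 : hat h (y - n * h) = h - (y - n * h) := by
    unfold hat; rw [abs_of_nonneg (by linarith), max_eq_right (by linarith)]
  have e2 : hat h (y - (n + 1 : ℤ) * h) = y - n * h := by
    push_cast
    unfold hat; rw [abs_of_nonpos (by linarith), max_eq_right (by linarith)]; ring
  have : HasSum (fun k : ℤ => hat h (y - k * h) * w k)
      (∑ k ∈ {n, n + 1}, hat h (y - k * h) * w k) := hasSum_sum_of_ne_finset_zero (by
      intro k hk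
      simp only [Finset.mem_insert, Finset.mem_singleton, not_or] at hk
      have : h ≤ |y - k * h| := by
        rcases lt_or_gt_of_ne hk.1 with hk1 | hk1
        · have : (k : ℝ) + 1 ≤ n := by exact_mod_cast hk1
          rw [abs_of_nonneg (by nlinarith)]; nlinarith
        · have : n + 2 ≤ k := by omega
          have : (n : ℝ) + 2 ≤ k := by exact_mod_cast this
          rw [abs_of_nonpos (by nlinarith)]; nlinarith
      rw [hat_eq_zero this, zero_mul])
  rw [Finset.sum_pair (by omega), e1, e2] at this
  exact this

theorem hasSum_hat {h : ℝ} (hh : 0 < h) (y : ℝ) : HasSum (fun k : ℤ => hat h (y - k * h)) h := by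
  obtain ⟨n, r, -, -, -, H⟩ := exists_hasSum_hat_mul hh y
  have := H fun _ => 1
  simpa using this

theorem summable_hat_mul {h : ℝ} (hh : 0 < h) (y : ℝ) (w : ℤ → ℝ) :
    Summable (fun k : ℤ => hat h (y - k * h) * w k) := by
  obtain ⟨n, r, -, -, -, H⟩ := exists_hasSum_hat_mul hh y
  exact (H w).summable

/-- A quantitative form of `W ∈ W^{2,∞}`: `W` is bounded by `B`, and up to an error
`M (z - y)²` it is affine near each point. -/
structure QuadraticBound (B M : ℝ) (W : ℝ → ℝ) : Prop where
  continuous : Continuous W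
  bound : ∀ x, |W x| ≤ B
  quadratic : ∃ D : ℝ → ℝ, ∀ y z, |W z - W y - D y * (z - y)| ≤ M * (z - y) ^ 2

theorem QuadraticBound.bound_nonneg {B M : ℝ} {W : ℝ → ℝ} (hW : QuadraticBound B M W) : 0 ≤ B :=
  (abs_nonneg _).trans (hW.bound 0)

theorem QuadraticBound.coeff_nonneg {B M : ℝ} {W : ℝ → ℝ} (hW : QuadraticBound B M W) :
    0 ≤ M := by
  obtain ⟨D, hD⟩ := hW.quadratic
  simpa using (abs_nonneg _).trans (hD 0 1)

theorem QuadraticBound.comp_sub_left {B M : ℝ} {W : ℝ → ℝ} (hW : QuadraticBound B M W) (x : ℝ) :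
    QuadraticBound B M fun y => W (x - y) := by
  obtain ⟨D, hD⟩ := hW.quadratic
  refine ⟨hW.continuous.comp (by fun_prop), fun y => hW.bound _, fun y => -D (x - y),
    fun y z => ?_⟩
  have := hD (x - y) (x - z)
  rw [show x - z - (x - y) = -(z - y) by ring] at this
  rwa [show -D (x - y) * (z - y) = D (x - y) * -(z - y) by ring, ← neg_sq (z - y)]

/-- The error of piecewise linear interpolation on the grid. -/
theorem QuadraticBound.abs_interpolation_le {B M : ℝ} {W : ℝ → ℝ} (hW : QuadraticBound B M W)
    {h : ℝ} (hh : 0 < h) (y : ℝ) :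
    |∑' k : ℤ, hat h (y - k * h) * W (k * h) - h * W y| ≤ h ^ 3 * M := by
  obtain ⟨D, hD⟩ := hW.quadratic
  have hM := hW.coeff_nonneg
  obtain ⟨n, r, hy, hr0, hrh, H⟩ := exists_hasSum_hat_mul hh y
  rw [(H fun k => W (k * h)).tsum_eq]
  have h1 := hD y (n * h)
  have h2 := hD y ((n + 1 : ℤ) * h)
  push_cast at h2 ⊢
  rw [show (n : ℝ) * h - y = -r by rw [hy]; ring] at h1
  rw [show ((n : ℝ) + 1) * h - y = h - r by rw [hy]; ring] at h2
  have b1 : M * (-r) ^ 2 ≤ M * h ^ 2 := by gcongr 1; nlinarith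
  have b2 : M * (h - r) ^ 2 ≤ M * h ^ 2 := by gcongr 1; nlinarith
  have h1' := abs_le.1 (h1.trans b1)
  have h2' := abs_le.1 (h2.trans b2)
  rw [abs_le]
  constructor <;> nlinarith [h1'.1, h1'.2, h2'.1, h2'.2]

/-! ### Masses of a density against the hats of the grid -/

theorem integrable_hat_mul {ν : Measure ℝ} {g : ℝ → ℝ} (hg : Integrable g ν) {h : ℝ} (hh : 0 ≤ h)
    (x : ℝ) : Integrable (fun y => hat h (y - x) * g y) ν :=
  hg.bdd_mul (c := h) (by fun_prop)
    (.of_forall fun y => by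
      rw [Real.norm_eq_abs, abs_of_nonneg (hat_nonneg _ _)]; exact hat_le hh _)

/-- The hats are nonnegative and sum to `h` at every point, so the local masses add up to at most
`h` times the total mass. -/
theorem sum_integral_hat_mul_abs_le {ν : Measure ℝ} {g : ℝ → ℝ} (hg : Integrable g ν) {h : ℝ}
    (hh : 0 < h) (s : Finset ℤ) :
    ∑ k ∈ s, ∫ y, hat h (y - k * h) * |g y| ∂ν ≤ h * ∫ y, |g y| ∂ν := by
  rw [← integral_finsetSum _ fun k _ => integrable_hat_mul hg.abs hh.le _, ← integral_const_mul]
  refine integral_mono (integrable_finsetSum _ fun k _ => integrable_hat_mul hg.abs hh.le _)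
    (hg.abs.const_mul h) fun y => ?_
  simp only
  rw [← Finset.sum_mul]
  gcongr
  exact sum_le_hasSum s (fun k _ => hat_nonneg _ _) (hasSum_hat hh y)

theorem summable_integral_hat_mul_abs {ν : Measure ℝ} {g : ℝ → ℝ} (hg : Integrable g ν) {h : ℝ}
    (hh : 0 < h) : Summable fun k : ℤ => ∫ y, hat h (y - k * h) * |g y| ∂ν :=
  summable_of_sum_le (fun _ => integral_nonneg fun _ => mul_nonneg (hat_nonneg _ _) (abs_nonneg _))
    (sum_integral_hat_mul_abs_le hg hh)

theorem tsum_integral_hat_mul_abs_le {ν : Measure ℝ} {g : ℝ → ℝ} (hg : Integrable g ν) {h : ℝ}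
    (hh : 0 < h) : ∑' k : ℤ, ∫ y, hat h (y - k * h) * |g y| ∂ν ≤ h * ∫ y, |g y| ∂ν :=
  (summable_integral_hat_mul_abs hg hh).tsum_le_of_sum_le (sum_integral_hat_mul_abs_le hg hh)

theorem abs_integral_hat_mul_le (ν : Measure ℝ) (g : ℝ → ℝ) (h x : ℝ) :
    |∫ y, hat h (y - x) * g y ∂ν| ≤ ∫ y, hat h (y - x) * |g y| ∂ν := by
  refine (abs_integral_le_integral_abs (f := fun y => hat h (y - x) * g y)).trans_eq
    (integral_congr_ae (.of_forall fun y => ?_))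
  simp only [abs_mul, abs_of_nonneg (hat_nonneg _ _)]

/-- Summable local masses justify exchanging sum and integral: weighting the masses by grid values
is integrating the interpolant. -/
theorem hasSum_integral_hat_mul {ν : Measure ℝ} {g : ℝ → ℝ} (hg : Integrable g ν) {h : ℝ}
    (hh : 0 < h) {w : ℤ → ℝ} {B : ℝ} (hw : ∀ k, |w k| ≤ B) :
    HasSum (fun k : ℤ => (∫ y, hat h (y - k * h) * g y ∂ν) * w k)
      (∫ y, (∑' k : ℤ, hat h (y - k * h) * w k) * g y ∂ν) := by
  have key := hasSum_integral_of_summable_integral_norm (μ := ν)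
    (F := fun (k : ℤ) y => (hat h (y - k * h) * g y) * w k)
    (fun k => (integrable_hat_mul hg hh.le _).mul_const _) (by
      refine Summable.of_nonneg_of_le (fun k => integral_nonneg fun y => norm_nonneg _)
        (fun k => ?_) ((summable_integral_hat_mul_abs hg hh).mul_right B)
      rw [← integral_mul_const]
      refine integral_mono ((integrable_hat_mul hg hh.le _).mul_const _).norm
        ((integrable_hat_mul hg.abs hh.le _).mul_const _) fun y => ?_
      simp only [Real.norm_eq_abs, abs_mul, abs_of_nonneg (hat_nonneg _ _)]
      have := hat_nonneg h (y - k * h)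
      gcongr
      exact hw k)
  simp only [integral_mul_const] at key
  have e : (fun y => (∑' k : ℤ, hat h (y - k * h) * w k) * g y) =
      fun y => ∑' k : ℤ, hat h (y - k * h) * g y * w k := funext fun y => by
    rw [← tsum_mul_right]
    congr 1; ext k; ring
  rw [e]
  exact key

/-- Quadrature by piecewise linear interpolation against the density `g`. -/
theorem QuadraticBound.abs_tsum_integral_hat_sub_le {B M : ℝ} {W : ℝ → ℝ}
    (hW : QuadraticBound B M W) {ν : Measure ℝ} {g : ℝ → ℝ} (hg : Integrable g ν) {h : ℝ}
    (hh : 0 < h) :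
    |∑' k : ℤ, (∫ y, hat h (y - k * h) * g y ∂ν) * W (k * h) - h * ∫ y, W y * g y ∂ν|
      ≤ h ^ 3 * M * ∫ y, |g y| ∂ν := by
  rw [(hasSum_integral_hat_mul hg hh fun k : ℤ => hW.bound (k * h)).tsum_eq]
  have hWg : Integrable (fun y => W y * g y) ν :=
    hg.bdd_mul (c := B) hW.continuous.aestronglyMeasurable
      (.of_forall hW.bound)
  have hE : ∀ y, |(∑' k : ℤ, hat h (y - k * h) * W (k * h)) * g y - h * (W y * g y)|
      ≤ h ^ 3 * M * |g y| := fun y => by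
    rw [← mul_assoc, ← sub_mul, abs_mul]
    gcongr
    exact hW.abs_interpolation_le hh y
  have hI : Integrable (fun y => (∑' k : ℤ, hat h (y - k * h) * W (k * h)) * g y) ν := by
    have hm : Measurable fun y : ℝ => ∑' k : ℤ, hat h (y - k * h) * W (k * h) :=
      measurable_of_tendsto_metrizable' (Filter.atTop : Filter (Finset ℤ))
        (f := fun (s : Finset ℤ) (y : ℝ) => ∑ k ∈ s, hat h (y - k * h) * W (k * h))
        (fun s => (by fun_prop : Continuous fun y : ℝ =>
          ∑ k ∈ s, hat h (y - (k : ℤ) * h) * W (k * h)).measurable)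
        (tendsto_pi_nhds.2 fun y => (summable_hat_mul hh y fun k => W (k * h)).hasSum)
    -- Integrability of the interpolant is read off from the interpolation error itself, which is
    -- dominated by a multiple of `|g|`.
    have : Integrable (fun y => (∑' k : ℤ, hat h (y - k * h) * W (k * h)) * g y
        - h * (W y * g y)) ν :=
      (hg.abs.const_mul (h ^ 3 * M)).mono'
        ((hm.aestronglyMeasurable.mul hg.aestronglyMeasurable).sub
          (hWg.const_mul h).aestronglyMeasurable) (.of_forall hE)
    exact (this.add (hWg.const_mul h)).congr (.of_forall fun y => by simp)
  rw [← integral_const_mul, ← integral_sub hI (hWg.const_mul h), ← integral_const_mul]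
  exact abs_integral_le_integral_abs.trans (integral_mono (hI.sub (hWg.const_mul h)).abs
    (hg.abs.const_mul _) hE)

theorem integral_hat {h : ℝ} (hh : 0 ≤ h) : ∫ z, hat h z = h ^ 2 := by
  have h1 : ∫ z, hat h z = ∫ z in -h..h, hat h z := by
    rw [intervalIntegral.integral_of_le (by linarith), setIntegral_eq_integral_of_forall_compl_eq_zero]
    intro z hz
    apply hat_eq_zero
    by_contra! hc
    exact hz ⟨(abs_lt.1 hc).1, (abs_lt.1 hc).2.le⟩
  have h2 : ∫ z in (0 : ℝ)..h, hat h z = h ^ 2 / 2 := by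
    rw [intervalIntegral.integral_congr (g := fun z => h - z)]
    · rw [intervalIntegral.integral_sub (by simp) (by simp), integral_id]
      simp; ring
    · intro z hz
      rw [uIcc_of_le hh] at hz
      simp only [hat]
      rw [abs_of_nonneg hz.1, max_eq_right (by linarith [hz.2])]
  have h3 : ∫ z in -h..(0 : ℝ), hat h z = h ^ 2 / 2 := by
    rw [← h2]
    have := intervalIntegral.integral_comp_neg (a := -h) (b := 0) (fun z => hat h z)
    simpa [hat_neg] using this
  rw [h1, ← intervalIntegral.integral_add_adjacent_intervals (b := 0)
    ((continuous_hat h).intervalIntegrable _ _) ((continuous_hat h).intervalIntegrable _ _), h2, h3]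
  ring

theorem integrable_hat (h : ℝ) : Integrable (hat h) :=
  (continuous_hat h).integrable_of_hasCompactSupport
    (HasCompactSupport.intro (isCompact_Icc (a := -h) (b := h)) fun z hz =>
      hat_eq_zero (by
        by_contra! hc
        exact hz ⟨(abs_lt.1 hc).1.le, (abs_lt.1 hc).2.le⟩))

/-! ### The trapezoidal rule for kernels whose second derivative is a measure -/

/-- The second differences of `a` are controlled by the finite measure `m`. -/
def SecondDiffBound (a : ℝ → ℝ) (m : Measure ℝ) : Prop :=
  ∀ x t : ℝ, 0 ≤ t → |a (x + t) - 2 * a x + a (x - t)| ≤ ∫ y, hat t (y - x) ∂m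

theorem integrable_hat_sub (m : Measure ℝ) [IsFiniteMeasure m] {h : ℝ} (hh : 0 ≤ h) (x : ℝ) :
    Integrable (fun y => hat h (y - x)) m := by
  simpa using integrable_hat_mul (integrable_const (1 : ℝ)) hh x

/-- The hat is even, so averaging over `t` and `-t` turns the deviation into an integral of second
differences, and `hat |t| ≤ hat h` where `hat h t` is nonzero. The bound is a local mass of `m`, not
its total mass, so it can be summed over the grid. -/
theorem SecondDiffBound.abs_integral_hat_sub_le {a : ℝ → ℝ} {m : Measure ℝ} [IsFiniteMeasure m]
    (ha : SecondDiffBound a m) (hi : Integrable a) {h : ℝ} (hh : 0 ≤ h) (x : ℝ) :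
    |(∫ y, hat h (y - x) * a y) - h ^ 2 * a x| ≤ h ^ 2 / 2 * ∫ y, hat h (y - x) ∂m := by
  have i1 : Integrable fun t => hat h t * a (x + t) := by
    simpa [add_comm] using (integrable_hat_mul hi hh x).comp_add_right x
  have i2 : Integrable fun t => hat h t * a (x - t) := by
    simpa [hat_neg, sub_eq_add_neg] using i1.comp_neg
  have e1 : ∫ y, hat h (y - x) * a y = ∫ t, hat h t * a (x + t) := by
    rw [← integral_add_right_eq_self _ x]; simp [add_comm]
  have e2 : ∫ t, hat h t * a (x - t) = ∫ t, hat h t * a (x + t) := by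
    rw [← integral_neg_eq_self]; simp [hat_neg]
  have i3 : Integrable fun t => 1 / 2 * (hat h t * a (x + t)) + 1 / 2 * (hat h t * a (x - t)) :=
    (i1.const_mul _).add (i2.const_mul _)
  have e3 : (∫ y, hat h (y - x) * a y) - h ^ 2 * a x =
      ∫ t, 1 / 2 * (hat h t * (a (x + t) - 2 * a x + a (x - t))) := by
    have : ∀ t, 1 / 2 * (hat h t * (a (x + t) - 2 * a x + a (x - t))) =
        1 / 2 * (hat h t * a (x + t)) + 1 / 2 * (hat h t * a (x - t)) - hat h t * a x := fun t => by
      ring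
    simp_rw [this]
    rw [integral_sub i3 ((integrable_hat h).mul_const _),
      integral_add (i1.const_mul _) (i2.const_mul _), integral_const_mul, integral_const_mul,
      integral_mul_const, integral_hat hh, e1, e2]
    ring
  have hb : ∀ t, |1 / 2 * (hat h t * (a (x + t) - 2 * a x + a (x - t)))| ≤
      hat h t * (1 / 2 * ∫ y, hat h (y - x) ∂m) := fun t => by
    rw [abs_mul, abs_mul, abs_of_nonneg (hat_nonneg h t), abs_of_nonneg (by norm_num : (0:ℝ) ≤ 1/2)]
    rcases le_or_gt h |t| with ht | ht
    · simp [hat_eq_zero ht]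
    have : |a (x + t) - 2 * a x + a (x - t)| ≤ ∫ y, hat h (y - x) ∂m := by
      have h1 : |a (x + t) - 2 * a x + a (x - t)| ≤ ∫ y, hat |t| (y - x) ∂m := by
        rcases abs_cases t with ⟨h1, h2⟩ | ⟨h1, h2⟩
        · simpa [h1] using ha x |t| (abs_nonneg t)
        · convert ha x |t| (abs_nonneg t) using 2
          rw [h1]; ring_nf
      exact h1.trans (integral_mono (integrable_hat_sub m (abs_nonneg t) x)
        (integrable_hat_sub m hh x) fun y => hat_mono ht.le _)
    have := hat_nonneg h t
    calc 1 / 2 * (hat h t * |a (x + t) - 2 * a x + a (x - t)|)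
        ≤ 1 / 2 * (hat h t * ∫ y, hat h (y - x) ∂m) := by gcongr
      _ = _ := by ring
  rw [e3]
  calc _ ≤ ∫ t, |1 / 2 * (hat h t * (a (x + t) - 2 * a x + a (x - t)))| :=
        abs_integral_le_integral_abs
    _ ≤ ∫ t, hat h t * (1 / 2 * ∫ y, hat h (y - x) ∂m) :=
        integral_mono_of_nonneg (.of_forall fun t => abs_nonneg _)
          ((integrable_hat h).mul_const _) (.of_forall hb)
    _ = _ := by rw [integral_mul_const, integral_hat hh]; ring

theorem summable_integral_hat {m : Measure ℝ} [IsFiniteMeasure m] {h : ℝ} (hh : 0 < h) :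
    Summable fun k : ℤ => ∫ y, hat h (y - k * h) ∂m := by
  simpa using summable_integral_hat_mul_abs (integrable_const (μ := m) (1 : ℝ)) hh

theorem tsum_integral_hat_le {m : Measure ℝ} [IsFiniteMeasure m] {h : ℝ} (hh : 0 < h) :
    ∑' k : ℤ, ∫ y, hat h (y - k * h) ∂m ≤ h * m.real univ := by
  simpa using tsum_integral_hat_mul_abs_le (integrable_const (μ := m) (1 : ℝ)) hh

/-- Integrability alone says nothing about grid values; the second-difference bound lets each be
replaced by a local average plus a summable correction. -/
theorem SecondDiffBound.abs_grid_le {a : ℝ → ℝ} {m : Measure ℝ} [IsFiniteMeasure m]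
    (ha : SecondDiffBound a m) (hi : Integrable a) {h : ℝ} (hh : 0 < h) (k : ℤ) :
    |h * a (k * h)| ≤ 1 / h * (∫ y, hat h (y - k * h) * |a y|)
      + h / 2 * ∫ y, hat h (y - k * h) ∂m := by
  have h1 := ha.abs_integral_hat_sub_le hi hh.le (k * h)
  have h2 := abs_integral_hat_mul_le volume a h (k * h)
  have h3 : |h ^ 2 * a (k * h)| ≤ (∫ y, hat h (y - k * h) * |a y|)
      + h ^ 2 / 2 * ∫ y, hat h (y - k * h) ∂m := by
    have := abs_sub_abs_le_abs_sub (h ^ 2 * a (k * h)) (∫ y, hat h (y - k * h) * a y)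
    rw [abs_sub_comm] at this
    linarith
  rw [show h * a (k * h) = 1 / h * (h ^ 2 * a (k * h)) by field_simp, abs_mul,
    abs_of_pos (one_div_pos.2 hh)]
  calc _ ≤ 1 / h * ((∫ y, hat h (y - k * h) * |a y|)
      + h ^ 2 / 2 * ∫ y, hat h (y - k * h) ∂m) := by gcongr
    _ = _ := by field_simp

theorem SecondDiffBound.summable_grid {a : ℝ → ℝ} {m : Measure ℝ} [IsFiniteMeasure m]
    (ha : SecondDiffBound a m) (hi : Integrable a) {h : ℝ} (hh : 0 < h) :
    Summable fun k : ℤ => |h * a (k * h)| :=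
  Summable.of_nonneg_of_le (fun _ => abs_nonneg _) (ha.abs_grid_le hi hh)
    (((summable_integral_hat_mul_abs hi hh).mul_left _).add
      ((summable_integral_hat hh).mul_left _))

theorem SecondDiffBound.tsum_grid_le {a : ℝ → ℝ} {m : Measure ℝ} [IsFiniteMeasure m]
    (ha : SecondDiffBound a m) (hi : Integrable a) {h : ℝ} (hh : 0 < h) :
    ∑' k : ℤ, |h * a (k * h)| ≤ (∫ y, |a y|) + h ^ 2 / 2 * m.real univ := by
  have s1 := (summable_integral_hat_mul_abs hi hh).mul_left (1 / h)
  have s2 := (summable_integral_hat (m := m) hh).mul_left (h / 2)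
  refine ((ha.summable_grid hi hh).tsum_le_tsum (ha.abs_grid_le hi hh) (s1.add s2)).trans ?_
  rw [s1.tsum_add s2, tsum_mul_left, tsum_mul_left]
  calc _ ≤ 1 / h * (h * ∫ y, |a y|) + h / 2 * (h * m.real univ) := by
        gcongr
        · exact tsum_integral_hat_mul_abs_le hi hh
        · exact tsum_integral_hat_le hh
    _ = _ := by field_simp

/-- The trapezoidal rule on the whole line. -/
theorem SecondDiffBound.abs_trapezoid_le {a : ℝ → ℝ} {m : Measure ℝ} [IsFiniteMeasure m]
    (ha : SecondDiffBound a m) (hi : Integrable a) {B M : ℝ} {W : ℝ → ℝ}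
    (hW : QuadraticBound B M W) {h : ℝ} (hh : 0 < h) :
    |∑' k : ℤ, h * a (k * h) * W (k * h) - ∫ y, W y * a y|
      ≤ (M * (∫ y, |a y|) + B / 2 * m.real univ) * h ^ 2 := by
  have hB := hW.bound_nonneg
  have h1 := hW.abs_tsum_integral_hat_sub_le hi hh
  have s1 := (hasSum_integral_hat_mul hi hh fun k : ℤ => hW.bound (k * h)).summable
  have s2 : Summable fun k : ℤ => h * a (k * h) * W (k * h) :=
    Summable.of_norm_bounded ((ha.summable_grid hi hh).mul_right B) fun k => by
      rw [Real.norm_eq_abs, abs_mul]; gcongr; exact hW.bound _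
  -- After multiplication by `h`, grid values of `a` are exchanged for hat averages. Each exchange
  -- costs `h²/2 * B` times a local mass, and the masses sum to at most `h * m.real univ`. The
  -- factor `h` is divided out at the end.
  have h2 : |∑' k : ℤ, (h * (h * a (k * h) * W (k * h))
      - (∫ y, hat h (y - k * h) * a y) * W (k * h))| ≤ h ^ 3 / 2 * B * m.real univ := by
    have hb : ∀ k : ℤ, ‖h * (h * a (k * h) * W (k * h))
        - (∫ y, hat h (y - k * h) * a y) * W (k * h)‖
        ≤ h ^ 2 / 2 * B * ∫ y, hat h (y - k * h) ∂m := fun k => by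
      rw [Real.norm_eq_abs, show h * (h * a (k * h) * W (k * h))
        - (∫ y, hat h (y - k * h) * a y) * W (k * h) =
        -((∫ y, hat h (y - k * h) * a y) - h ^ 2 * a (k * h)) * W (k * h) by ring, abs_mul, abs_neg]
      calc _ ≤ h ^ 2 / 2 * (∫ y, hat h (y - k * h) ∂m) * B := by
            gcongr
            · exact mul_nonneg (by positivity) (integral_nonneg fun y => hat_nonneg _ _)
            · exact ha.abs_integral_hat_sub_le hi hh.le _
            · exact hW.bound _
        _ = _ := by ring
    have hs := (summable_integral_hat (m := m) hh).mul_left (h ^ 2 / 2 * B)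
    refine (tsum_of_norm_bounded hs.hasSum hb).trans ?_
    rw [tsum_mul_left]
    calc _ ≤ h ^ 2 / 2 * B * (h * m.real univ) := by gcongr; exact tsum_integral_hat_le hh
      _ = _ := by ring
  rw [(s2.mul_left h).tsum_sub s1, tsum_mul_left] at h2
  have h3 : |h * (∑' k : ℤ, h * a (k * h) * W (k * h) - ∫ y, W y * a y)| ≤
      h * ((M * (∫ y, |a y|) + B / 2 * m.real univ) * h ^ 2) := by
    have e1 := abs_le.1 h1
    have e2 := abs_le.1 h2
    rw [abs_le]
    constructor <;> nlinarith [e1.1, e1.2, e2.1, e2.2]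
  rw [abs_mul, abs_of_pos hh] at h3
  exact le_of_mul_le_mul_left h3 hh

/-! ### Continuous representatives and weak derivatives -/

theorem contRep_eq {c g : ℝ → ℝ} (hc : Continuous c) (h : c =ᵐ[volume] g) : contRep g = c := by
  have hex : ∃ c : ℝ → ℝ, Continuous c ∧ c =ᵐ[volume] g := ⟨c, hc, h⟩
  rw [contRep, dif_pos hex]
  exact (hex.choose_spec.1.ae_eq_iff_eq volume hc).1 (hex.choose_spec.2.trans h.symm)

theorem IsTestFunction.integrable_mul {v φ : ℝ → ℝ} (hv : LocallyIntegrable v)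
    (hφ : IsTestFunction φ) : Integrable fun x => v x * φ x := by
  simpa using hv.integrable_smul_right_of_hasCompactSupport hφ.1.continuous hφ.2

theorem IsTestFunction.deriv {φ : ℝ → ℝ} (hφ : IsTestFunction φ) : IsTestFunction (deriv φ) :=
  ⟨(contDiff_infty_iff_deriv.1 hφ.1).2, hφ.2.deriv⟩

theorem IsTestFunction.exists_support_subset {φ : ℝ → ℝ} (hφ : IsTestFunction φ) (r : ℝ) :
    ∃ R, r ≤ R ∧ ∀ x, R ≤ |x| → φ x = 0 := by
  obtain ⟨R, hR⟩ := hφ.2.isCompact.isBounded.subset_ball 0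
  refine ⟨max r R, le_max_left _ _, fun x hx => ?_⟩
  by_contra h
  have := hR (subset_tsupport φ h)
  simp at this
  exact absurd hx (by simp [this])

theorem IsWeakDeriv.ae_eq {u v w : ℝ → ℝ} (hv : IsWeakDeriv u v) (hw : IsWeakDeriv u w) :
    v =ᵐ[volume] w := by
  have := ae_eq_zero_of_integral_contDiff_smul_eq_zero (hv.2.1.sub hw.2.1) fun g hg hg' => by
    have h1 := hv.2.2 g ⟨hg, hg'⟩
    have h2 := hw.2.2 g ⟨hg, hg'⟩
    have i1 := IsTestFunction.integrable_mul hv.2.1 ⟨hg, hg'⟩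
    have i2 := IsTestFunction.integrable_mul hw.2.1 ⟨hg, hg'⟩
    have : ∀ x, g x • (v - w) x = v x * g x - w x * g x := fun x => by simp; ring
    simp_rw [this]
    rw [integral_sub i1 i2]
    linarith
  filter_upwards [this] with x hx
  simpa [sub_eq_zero] using hx

theorem hasDerivAt_primitive {θ : ℝ → ℝ} (hθ : Continuous θ) (c x : ℝ) :
    HasDerivAt (fun x => ∫ t in c..x, θ t) (θ x) x :=
  (hθ.integral_hasStrictDerivAt c x).hasDerivAt

theorem contDiff_primitive {θ : ℝ → ℝ} (hθ : ContDiff ℝ ∞ θ) (c : ℝ) :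
    ContDiff ℝ ∞ fun x => ∫ t in c..x, θ t :=
  contDiff_infty_iff_deriv.2 ⟨fun x => (hasDerivAt_primitive hθ.continuous c x).differentiableAt, by
    rwa [funext fun x => (hasDerivAt_primitive hθ.continuous c x).deriv]⟩

theorem intervalIntegral_eq_integral_of_forall {g : ℝ → ℝ} {R : ℝ} (hR : 0 ≤ R)
    (hg : ∀ x, R ≤ |x| → g x = 0) : ∫ x in -R..R, g x = ∫ x, g x := by
  rw [intervalIntegral.integral_of_le (by linarith), setIntegral_eq_integral_of_forall_compl_eq_zero]
  intro z hz
  apply hg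
  by_contra! hc
  exact hz ⟨(abs_lt.1 hc).1, (abs_lt.1 hc).2.le⟩

/-- A test function of vanishing integral is the derivative of a test function. -/
theorem IsTestFunction.exists_deriv_eq {θ : ℝ → ℝ} (hθ : IsTestFunction θ) (h0 : ∫ x, θ x = 0) :
    ∃ φ, IsTestFunction φ ∧ _root_.deriv φ = θ := by
  obtain ⟨R, hR, hz⟩ := hθ.exists_support_subset 0
  refine ⟨fun x => ∫ t in (-R)..x, θ t, ⟨contDiff_primitive hθ.1 _, ?_⟩,
    funext fun x => (hasDerivAt_primitive hθ.1.continuous _ x).deriv⟩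
  refine HasCompactSupport.intro (isCompact_Icc (a := -R) (b := R)) fun x hx => ?_
  rcases lt_or_ge x (-R) with h | h
  · rw [intervalIntegral.integral_congr (g := fun _ => 0)]
    · simp
    · intro t ht
      rw [uIcc_of_ge h.le] at ht
      exact hz t (by rw [abs_of_nonpos (by linarith [ht.2])]; linarith [ht.2])
  · have h' : R < x := by
      by_contra! hc
      exact hx ⟨h, hc⟩
    rw [← intervalIntegral.integral_add_adjacent_intervals (b := R)
      (hθ.1.continuous.intervalIntegrable _ _) (hθ.1.continuous.intervalIntegrable _ _),
      intervalIntegral_eq_integral_of_forall hR hz, h0,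
      intervalIntegral.integral_congr (g := fun _ => 0)]
    · simp
    · intro t ht
      rw [uIcc_of_le h'.le] at ht
      exact hz t (by rw [abs_of_nonneg (by linarith [ht.1])]; linarith [ht.1])

/-- A function whose weak derivative vanishes is constant. -/
theorem exists_ae_eq_const {d : ℝ → ℝ} (hd : LocallyIntegrable d)
    (h : ∀ φ, IsTestFunction φ → ∫ x, d x * deriv φ x = 0) : ∃ C, ∀ᵐ x, d x = C := by
  let b : ContDiffBump (0 : ℝ) := ⟨1, 2, by norm_num, by norm_num⟩
  have hη : IsTestFunction (b.normed volume) := ⟨b.contDiff_normed, b.hasCompactSupport_normed⟩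
  have hη1 : ∫ x, b.normed volume x = 1 := b.integral_normed
  refine ⟨∫ x, d x * b.normed volume x, ?_⟩
  have hc : LocallyIntegrable fun _ : ℝ => ∫ x, d x * b.normed volume x :=
    continuous_const.locallyIntegrable
  have := ae_eq_zero_of_integral_contDiff_smul_eq_zero (hd.sub hc) fun ψ hψ hψ' => by
    have hψt : IsTestFunction ψ := ⟨hψ, hψ'⟩
    have iψ : Integrable ψ := hψ.continuous.integrable_of_hasCompactSupport hψ'
    have hθ : IsTestFunction fun x => ψ x - (∫ y, ψ y) * b.normed volume x :=
      ⟨hψ.sub (contDiff_const.mul hη.1), hψ'.sub hη.2.mul_left⟩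
    -- Subtracting the right multiple of a bump of integral one makes the integral vanish, so the
    -- difference is a derivative and the hypothesis applies to it.
    obtain ⟨φ, hφ, hφ'⟩ := hθ.exists_deriv_eq (by
      rw [integral_sub iψ (b.integrable_normed.const_mul _), integral_const_mul, hη1]; simp)
    have h1 := h φ hφ
    rw [hφ'] at h1
    have i1 := IsTestFunction.integrable_mul hd hψt
    have i2 := IsTestFunction.integrable_mul hd hη
    have e1 : ∀ x, d x * (ψ x - (∫ y, ψ y) * b.normed volume x) =
        d x * ψ x - (∫ y, ψ y) * (d x * b.normed volume x) := fun x => by ring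
    simp_rw [e1] at h1
    rw [integral_sub i1 (i2.const_mul _), integral_const_mul] at h1
    have e2 : ∀ x, ψ x • (d - fun _ : ℝ => ∫ y, d y * b.normed volume y) x =
        d x * ψ x - ψ x * ∫ x, d x * b.normed volume x := fun x => by
      simp; ring
    simp_rw [e2]
    rw [integral_sub i1 (iψ.mul_const _), integral_mul_const]
    exact h1
  filter_upwards [this] with x hx
  simpa [sub_eq_zero] using hx

/-- Integration by parts for the absolutely continuous primitive, on an interval outside which `φ`
and its derivative vanish; Lebesgue differentiation identifies the derivative of the primitive
almost everywhere. -/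
theorem integral_primitive_mul_deriv {v φ : ℝ → ℝ} (hv : LocallyIntegrable v)
    (hφ : IsTestFunction φ) :
    ∫ x, (∫ t in (0 : ℝ)..x, v t) * deriv φ x = -∫ x, v x * φ x := by
  obtain ⟨R, hR, hz⟩ := hφ.exists_support_subset 0
  obtain ⟨R', hR', hz'⟩ := hφ.deriv.exists_support_subset R
  have hz'' : ∀ x, R' ≤ |x| → φ x = 0 := fun x hx => hz x (hR'.trans hx)
  have hR0 : 0 ≤ R' := hR.trans hR'
  have hvi : IntervalIntegrable v volume (-R') R' :=
    (hv.integrableOn_isCompact isCompact_uIcc).intervalIntegrable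
  have ac := hvi.absolutelyContinuousOnInterval_intervalIntegral (c := 0)
    (by rw [uIcc_of_le (by linarith)]; exact ⟨by linarith, hR0⟩)
  have ac2 : AbsolutelyContinuousOnInterval φ (-R') R' :=
    (hφ.1.of_le (by simp)).contDiffOn.absolutelyContinuousOnInterval
  have key := ac.integral_mul_deriv_eq_deriv_mul ac2
  rw [hz'' R' (le_abs_self _), hz'' (-R') (by rw [abs_neg]; exact le_abs_self _)] at key
  rw [← intervalIntegral_eq_integral_of_forall hR0 (fun x hx => by rw [hz' x hx, mul_zero]), key,
    ← intervalIntegral_eq_integral_of_forall hR0 (fun x hx => by rw [hz'' x hx, mul_zero])]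
  simp only [mul_zero, sub_self, zero_sub, neg_inj]
  refine intervalIntegral.integral_congr_ae ?_
  filter_upwards [_root_.LocallyIntegrable.ae_hasDerivAt_integral hv] with x hx _
  rw [(hx 0).deriv]

/-- The difference of `u` and the primitive of `v` has zero weak derivative, so `u` is almost
everywhere that primitive plus a constant. -/
theorem IsWeakDeriv.exists_continuous {u v : ℝ → ℝ} (h : IsWeakDeriv u v) :
    ∃ c : ℝ → ℝ, Continuous c ∧ c =ᵐ[volume] u := by
  have hc : Continuous fun x => ∫ t in (0 : ℝ)..x, v t :=
    intervalIntegral.continuous_primitive (fun a b => (h.2.1.integrableOn_isCompact isCompact_uIcc).intervalIntegrable) 0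
  obtain ⟨C, hC⟩ := exists_ae_eq_const (h.1.sub hc.locallyIntegrable) fun φ hφ => by
    have i1 := IsTestFunction.integrable_mul h.1 hφ.deriv
    have i2 := IsTestFunction.integrable_mul hc.locallyIntegrable hφ.deriv
    have := integral_primitive_mul_deriv h.2.1 hφ
    simp only [Pi.sub_apply, sub_mul]
    rw [integral_sub i1 i2, this, h.2.2 φ hφ, sub_self]
  refine ⟨fun x => (∫ t in (0 : ℝ)..x, v t) + C, hc.add continuous_const, ?_⟩
  filter_upwards [hC] with x hx
  simp only [Pi.sub_apply] at hx
  linarith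

/-- The weak derivative of `α` has a weak derivative in turn, hence a continuous representative;
uniqueness makes the choices in `weakDeriv` and `contRep` harmless. -/
theorem kernelDeriv_spec {α : ℝ → ℝ} (h : MemW 2 1 α) :
    Continuous (kernelDeriv α) ∧ Integrable (kernelDeriv α) ∧ IsWeakDeriv α (kernelDeriv α) := by
  obtain ⟨-, v, hv, hvi, w, hw, -⟩ := h
  obtain ⟨c, hc, hcv⟩ := hw.exists_continuous
  have hex : ∃ v, IsWeakDeriv α v := ⟨v, hv⟩
  have hwd : IsWeakDeriv α (weakDeriv α) := by
    rw [weakDeriv, dif_pos hex]; exact hex.choose_spec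
  have : kernelDeriv α = c := contRep_eq hc (hcv.trans (hv.ae_eq hwd))
  rw [this]
  refine ⟨hc, (memLp_one_iff_integrable.1 hvi).congr hcv.symm, hv.1, hc.locallyIntegrable,
    fun φ hφ => ?_⟩
  rw [hv.2.2 φ hφ]
  congr 1
  refine integral_congr_ae ?_
  filter_upwards [hcv] with x hx
  rw [hx]

/-! ### The second differences of `α'` -/

theorem integral_signedMeasure_eq (μ : SignedMeasure ℝ) {g : ℝ → ℝ}
    (hp : Integrable g μ.toJordanDecomposition.posPart)
    (hn : Integrable g μ.toJordanDecomposition.negPart) :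
    ∫ᵛ x, g x ∂•μ = (∫ x, g x ∂μ.toJordanDecomposition.posPart)
      - ∫ x, g x ∂μ.toJordanDecomposition.negPart := by
  -- The pairing under the integral is multiplication of reals, which equals its own flip.
  have hB : (ContinuousLinearMap.lsmul ℝ ℝ : ℝ →L[ℝ] ℝ →L[ℝ] ℝ) =
      (ContinuousLinearMap.lsmul ℝ ℝ).flip := by ext; simp
  conv_lhs => rw [← μ.toSignedMeasure_toJordanDecomposition]
  rw [JordanDecomposition.toSignedMeasure, hB, VectorMeasure.integral_sub_vectorMeasure,
    VectorMeasure.integral_toSignedMeasure, VectorMeasure.integral_toSignedMeasure]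
  · simpa [VectorMeasure.Integrable] using hp
  · simpa [VectorMeasure.Integrable] using hn

/-- A smooth approximation of the positive part, with its first two derivatives. -/
theorem exists_smooth_posPart {ε : ℝ} (hε : 0 < ε) :
    ∃ Q P ρ : ℝ → ℝ, ContDiff ℝ ∞ Q ∧ (∀ y, HasDerivAt Q (P y) y) ∧ (∀ y, HasDerivAt P (ρ y) y) ∧
      (∀ y, |Q y - max 0 y| ≤ 3 * ε) ∧ (∀ y, y ≤ -ε → Q y = 0) ∧ (∀ y, ε ≤ y → Q y = Q ε + (y - ε)) ∧
      Continuous ρ ∧ (∀ y, 0 ≤ ρ y) ∧ (∀ y, ε ≤ |y| → ρ y = 0) ∧ Integrable ρ ∧ ∫ y, ρ y = 1 := by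
  let b : ContDiffBump (0 : ℝ) := ⟨ε / 2, ε, by positivity, by linarith⟩
  let ρ := b.normed volume
  have hρ : ContDiff ℝ ∞ ρ := b.contDiff_normed
  have hρ0 : ∀ y, 0 ≤ ρ y := b.nonneg_normed
  have hρz : ∀ y, ε ≤ |y| → ρ y = 0 := fun y hy => by
    have : y ∉ Function.support (b.normed volume) := by
      rw [b.support_normed_eq]; simpa [b] using hy
    simpa using this
  have hρ1 : ∫ y, ρ y = 1 := b.integral_normed
  -- Integrating the bump twice: `P` climbs from 0 to 1 across `[-ε, ε]`, and its primitive `Q` is 0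
  -- to the left and has slope one to the right.
  let P : ℝ → ℝ := fun y => ∫ t in (-ε)..y, ρ t
  have hP : ContDiff ℝ ∞ P := contDiff_primitive hρ _
  have hPd : ∀ y, HasDerivAt P (ρ y) y := hasDerivAt_primitive hρ.continuous _
  have hPm : Monotone P := monotone_of_hasDerivAt_nonneg hPd hρ0
  have hPl : P (-ε) = 0 := intervalIntegral.integral_same
  have hPr : P ε = 1 := by
    rw [← hρ1]; exact intervalIntegral_eq_integral_of_forall hε.le hρz
  have hPl' : ∀ y, y ≤ -ε → P y = 0 := fun y hy => by
    rw [← hPl]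
    refine (constant_of_has_deriv_right_zero (f := P) (a := y) (b := -ε) hP.continuous.continuousOn
      (fun x hx => ?_) (-ε) ⟨hy, le_rfl⟩).symm
    have := (hPd x).hasDerivWithinAt (s := Ici x)
    rwa [hρz x (by rw [abs_of_nonpos (by linarith [hx.2])]; linarith [hx.2])] at this
  have hPr' : ∀ y, ε ≤ y → P y = 1 := fun y hy => by
    rw [← hPr]
    refine (constant_of_has_deriv_right_zero (f := P) (a := ε) (b := y) hP.continuous.continuousOn
      (fun x hx => ?_) y ⟨hy, le_rfl⟩)
    have := (hPd x).hasDerivWithinAt (s := Ici x)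
    rwa [hρz x (by rw [abs_of_nonneg (by linarith [hx.1])]; linarith [hx.1])] at this
  have hP0 : ∀ y, 0 ≤ P y := fun y => by
    rcases le_total y (-ε) with h | h
    · rw [hPl' y h]
    · rw [← hPl]; exact hPm h
  have hP1 : ∀ y, P y ≤ 1 := fun y => by
    rcases le_total ε y with h | h
    · rw [hPr' y h]
    · rw [← hPr]; exact hPm h
  let Q : ℝ → ℝ := fun y => ∫ t in (-ε)..y, P t
  have hQd : ∀ y, HasDerivAt Q (P y) y := hasDerivAt_primitive hP.continuous _
  have hQ : ContDiff ℝ ∞ Q := contDiff_primitive hP _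
  have hQl : Q (-ε) = 0 := intervalIntegral.integral_same
  have hQl' : ∀ y, y ≤ -ε → Q y = 0 := fun y hy => by
    rw [← hQl]
    refine (constant_of_has_deriv_right_zero (f := Q) (a := y) (b := -ε) hQ.continuous.continuousOn
      (fun x hx => ?_) (-ε) ⟨hy, le_rfl⟩).symm
    have := (hQd x).hasDerivWithinAt (s := Ici x)
    rwa [hPl' x hx.2.le] at this
  have hQr' : ∀ y, ε ≤ y → Q y = Q ε + (y - ε) := fun y hy => by
    have := constant_of_has_deriv_right_zero (f := fun y => Q y - y) (a := ε) (b := y)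
      (hQ.continuous.sub continuous_id).continuousOn (fun x hx => by
        have := ((hQd x).sub (hasDerivAt_id x)).hasDerivWithinAt (s := Ici x)
        rw [hPr' x hx.1, sub_self] at this
        exact this) y ⟨hy, le_rfl⟩
    linarith
  have hQm : Monotone Q := monotone_of_hasDerivAt_nonneg hQd hP0
  -- Together with the monotonicity of `Q`, this confines `Q ε` to `[0, 2ε]` without computing it.
  have hQa : Monotone fun y => y - Q y :=
    monotone_of_hasDerivAt_nonneg (f' := fun y => 1 - P y)
      (fun y => (hasDerivAt_id y).sub (hQd y)) fun y => by simpa using hP1 y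
  have hQε : 0 ≤ Q ε ∧ Q ε ≤ 2 * ε := by
    have h1 := hQm (show -ε ≤ ε by linarith)
    have h2 := hQa (show -ε ≤ ε by linarith)
    simp only [hQl] at h1 h2
    exact ⟨h1, by linarith⟩
  refine ⟨Q, P, ρ, hQ, hQd, hPd, fun y => ?_, hQl', hQr', hρ.continuous, hρ0, hρz,
    b.integrable_normed, hρ1⟩
  rcases le_total y (-ε) with h | h
  · rw [hQl' y h, max_eq_left (by linarith)]; simp; linarith
  rcases le_total ε y with h' | h'
  · rw [hQr' y h', max_eq_right (by linarith), abs_le]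
    constructor <;> linarith [hQε.1, hQε.2]
  · have h1 := hQm h
    have h2 := hQm h'
    rw [hQl] at h1
    rw [abs_le]
    rcases max_cases 0 y with ⟨h3, h4⟩ | ⟨h3, h4⟩ <;> rw [h3] <;> constructor <;> linarith [hQε.2]

/-- Approximate identity: `ρ (· - z)` is a probability density carried by `|y - z| < ε`, so the
average of `a` is off by at most its oscillation there. -/
theorem abs_integral_mul_sub_le {a ρ : ℝ → ℝ} {ε δ : ℝ} (z : ℝ) (ha : Continuous a)
    (hδ : ∀ y, |y - z| < ε → |a y - a z| ≤ δ) (hc : Continuous ρ) (h0 : ∀ y, 0 ≤ ρ y)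
    (hz : ∀ y, ε ≤ |y| → ρ y = 0) (hi : Integrable ρ) (h1 : ∫ y, ρ y = 1) :
    Integrable (fun y => a y * ρ (y - z)) ∧ |(∫ y, a y * ρ (y - z)) - a z| ≤ δ := by
  have hcs : HasCompactSupport fun y => ρ (y - z) :=
    HasCompactSupport.intro (isCompact_Icc (a := z - ε) (b := z + ε)) fun y hy =>
      hz _ (by
        by_contra! hlt
        rw [abs_lt] at hlt
        exact hy ⟨by linarith, by linarith⟩)
  have i1 : Integrable fun y => a y * ρ (y - z) :=
    (ha.mul (by fun_prop)).integrable_of_hasCompactSupport hcs.mul_left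
  have i2 : Integrable fun y => ρ (y - z) := hi.comp_sub_right z
  refine ⟨i1, ?_⟩
  have e : (∫ y, a y * ρ (y - z)) - a z = ∫ y, (a y - a z) * ρ (y - z) := by
    simp_rw [sub_mul]
    rw [integral_sub i1 (i2.const_mul _), integral_const_mul, integral_sub_right_eq_self, h1, mul_one]
  rw [e]
  calc |∫ y, (a y - a z) * ρ (y - z)| ≤ ∫ y, |(a y - a z) * ρ (y - z)| :=
        abs_integral_le_integral_abs
    _ ≤ ∫ y, δ * ρ (y - z) := by
        refine integral_mono_of_nonneg (.of_forall fun y => abs_nonneg _) (i2.const_mul _)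
          (.of_forall fun y => ?_)
        simp only [abs_mul, abs_of_nonneg (h0 _)]
        rcases lt_or_ge |y - z| ε with h | h
        · exact mul_le_mul_of_nonneg_right (hδ y h) (h0 _)
        · simp [hz _ h]
    _ = δ := by rw [integral_const_mul, integral_sub_right_eq_self, h1, mul_one]

/-- Formally, the hypothesis is tested against `hat t (· - x)`, whose second derivative is `δ_{x-t}
- 2 δ_x + δ_{x+t}`. The hat is not smooth, so it is replaced by the second difference of a smoothed
positive part, and the error is sent to zero. -/
theorem secondDiff_eq_integral_hat {a : ℝ → ℝ} (ha : Continuous a) {p n : Measure ℝ}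
    [IsFiniteMeasure p] [IsFiniteMeasure n]
    (h : ∀ φ, IsTestFunction φ → ∫ x, a x * deriv (deriv φ) x = (∫ x, φ x ∂p) - ∫ x, φ x ∂n)
    (x : ℝ) {t : ℝ} (ht : 0 ≤ t) :
    a (x + t) - 2 * a x + a (x - t) = (∫ y, hat t (y - x) ∂p) - ∫ y, hat t (y - x) ∂n := by
  -- The 4 is `1 + 2 + 1` oscillations of `a`, each at most `δ`. The 12 is the same count of errors
  -- `3ε ≤ 3δ` in the smoothed positive part, paid against each measure.
  have key : ∀ δ : ℝ, 0 < δ → |a (x + t) - 2 * a x + a (x - t)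
      - ((∫ y, hat t (y - x) ∂p) - ∫ y, hat t (y - x) ∂n)|
      ≤ (4 + 12 * (p.real univ + n.real univ)) * δ := by
    intro δ hδ
    have hosc : ∀ z, ∃ ε > 0, ∀ y, |y - z| < ε → |a y - a z| ≤ δ := fun z => by
      obtain ⟨ε, hε, H⟩ := Metric.continuous_iff.1 ha z δ hδ
      exact ⟨ε, hε, fun y hy => (H y hy).le⟩
    obtain ⟨ε₁, hε₁, H₁⟩ := hosc (x + t)
    obtain ⟨ε₂, hε₂, H₂⟩ := hosc x
    obtain ⟨ε₃, hε₃, H₃⟩ := hosc (x - t)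
    obtain ⟨ε, hε, h1, h2, h3, h4⟩ : ∃ ε > 0, ε ≤ ε₁ ∧ ε ≤ ε₂ ∧ ε ≤ ε₃ ∧ ε ≤ δ :=
      ⟨min (min ε₁ ε₂) (min ε₃ δ), by positivity, by simp, by simp, by simp, by simp⟩
    obtain ⟨Q, P, ρ, hQ, hQd, hPd, hQa, hQl, hQr, hρc, hρ0, hρz, hρi, hρ1⟩ :=
      exists_smooth_posPart hε
    obtain ⟨i1, b1⟩ := abs_integral_mul_sub_le (x + t) ha (fun y hy => H₁ y (hy.trans_le h1))
      hρc hρ0 hρz hρi hρ1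
    obtain ⟨i2, b2⟩ := abs_integral_mul_sub_le x ha (fun y hy => H₂ y (hy.trans_le h2))
      hρc hρ0 hρz hρi hρ1
    obtain ⟨i3, b3⟩ := abs_integral_mul_sub_le (x - t) ha (fun y hy => H₃ y (hy.trans_le h3))
      hρc hρ0 hρz hρi hρ1
    let φ : ℝ → ℝ := fun y => Q (y - (x - t)) - 2 * Q (y - x) + Q (y - (x + t))
    have hφ : IsTestFunction φ := by
      refine ⟨?_, HasCompactSupport.intro (isCompact_Icc (a := x - t - ε) (b := x + t + ε))
        fun y hy => ?_⟩
      · exact ((hQ.comp (contDiff_id.sub contDiff_const)).sub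
          (contDiff_const.mul (hQ.comp (contDiff_id.sub contDiff_const)))).add
          (hQ.comp (contDiff_id.sub contDiff_const))
      · rcases lt_or_ge y (x - t - ε) with h | h
        · simp only [φ]
          rw [hQl _ (by linarith), hQl _ (by linarith), hQl _ (by linarith)]; ring
        · have h' : x + t + ε < y := by
            by_contra! hc
            exact hy ⟨h, hc⟩
          simp only [φ]
          -- The value `Q ε` enters with coefficients `1, -2, 1` and cancels, so only slope one
          -- matters to the right of the support.
          rw [hQr (y - (x - t)) (by linarith), hQr (y - x) (by linarith),
            hQr (y - (x + t)) (by linarith)]; ring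
    have hφ1 : deriv φ = fun y => P (y - (x - t)) - 2 * P (y - x) + P (y - (x + t)) :=
      funext fun y => HasDerivAt.deriv
        ((((hQd _).comp_sub_const y (x - t)).sub (((hQd _).comp_sub_const y x).const_mul 2)).add
          ((hQd _).comp_sub_const y (x + t)))
    have hφ2 : deriv (deriv φ) = fun y => ρ (y - (x - t)) - 2 * ρ (y - x) + ρ (y - (x + t)) := by
      rw [hφ1]
      exact funext fun y => HasDerivAt.deriv
        ((((hPd _).comp_sub_const y (x - t)).sub (((hPd _).comp_sub_const y x).const_mul 2)).add
          ((hPd _).comp_sub_const y (x + t)))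
    have e1 : ∫ y, a y * deriv (deriv φ) y = (∫ y, a y * ρ (y - (x - t)))
        - 2 * (∫ y, a y * ρ (y - x)) + ∫ y, a y * ρ (y - (x + t)) := by
      have i4 : Integrable fun y => a y * ρ (y - (x - t)) - 2 * (a y * ρ (y - x)) :=
        i3.sub (i2.const_mul 2)
      rw [hφ2, ← integral_const_mul, ← integral_sub i3 (i2.const_mul 2), ← integral_add i4 i1]
      congr 1; ext y; ring
    have hd : ∀ y, |φ y - hat t (y - x)| ≤ 12 * δ := fun y => by
      rw [hat_eq_posPart _ _ ht]
      simp only [φ]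
      have c1 := abs_le.1 (hQa (y - (x - t)))
      have c2 := abs_le.1 (hQa (y - x))
      have c3 := abs_le.1 (hQa (y - (x + t)))
      rw [show y - x + t = y - (x - t) by ring, show y - x - t = y - (x + t) by ring, abs_le]
      constructor <;> linarith [c1.1, c1.2, c2.1, c2.2, c3.1, c3.2]
    have hm : ∀ (m : Measure ℝ) [IsFiniteMeasure m],
        |(∫ y, φ y ∂m) - ∫ y, hat t (y - x) ∂m| ≤ 12 * δ * m.real univ := fun m _ => by
      have iφ : Integrable φ m := hφ.1.continuous.integrable_of_hasCompactSupport hφ.2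
      rw [← integral_sub iφ (integrable_hat_sub m ht x)]
      exact norm_integral_le_of_norm_le_const (C := 12 * δ)
        (f := fun y => φ y - hat t (y - x)) (.of_forall hd)
    have hh := h φ hφ
    rw [e1] at hh
    have d1 := abs_le.1 (hm p)
    have d2 := abs_le.1 (hm n)
    rw [abs_le] at b1 b2 b3 ⊢
    constructor <;> linarith [d1.1, d1.2, d2.1, d2.2, b1.1, b1.2, b2.1, b2.2, b3.1, b3.2]
  set K := 4 + 12 * (p.real univ + n.real univ) with hK
  have hKpos : 0 < K := by positivity
  have : |a (x + t) - 2 * a x + a (x - t)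
      - ((∫ y, hat t (y - x) ∂p) - ∫ y, hat t (y - x) ∂n)| ≤ 0 :=
    le_of_forall_pos_le_add fun δ hδ => by
      have := key (δ / K) (by positivity)
      rwa [mul_div_cancel₀ _ hKpos.ne', ← zero_add δ] at this
  exact sub_eq_zero.1 (abs_nonpos_iff.1 this)

/-- Testing the weak derivative against `φ''` and the third derivative against `φ` gives `∫ α' φ'' =
∫ φ dμ`, the input of the hat formula for the two Jordan parts. -/
theorem IsThirdDerivMeasure.secondDiff_kernelDeriv {α : ℝ → ℝ} {μ : SignedMeasure ℝ}
    (hμ : IsThirdDerivMeasure α μ) (hα : MemW 2 1 α) (x : ℝ) {t : ℝ} (ht : 0 ≤ t) :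
    kernelDeriv α (x + t) - 2 * kernelDeriv α x + kernelDeriv α (x - t) =
      (∫ y, hat t (y - x) ∂μ.toJordanDecomposition.posPart)
        - ∫ y, hat t (y - x) ∂μ.toJordanDecomposition.negPart := by
  obtain ⟨hc, -, hw⟩ := kernelDeriv_spec hα
  refine secondDiff_eq_integral_hat hc (fun φ hφ => ?_) x ht
  have hI : ∀ (m : Measure ℝ) [IsFiniteMeasure m], Integrable φ m := fun m _ =>
    hφ.1.continuous.integrable_of_hasCompactSupport hφ.2
  have h1 := hw.2.2 (deriv (deriv φ)) hφ.deriv.deriv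
  have h2 := hμ φ hφ
  rw [integral_signedMeasure_eq μ (hI _) (hI _)] at h2
  have h3 : iteratedDeriv 3 φ = deriv (deriv (deriv φ)) := by
    rw [iteratedDeriv_succ, iteratedDeriv_succ, iteratedDeriv_one]
  rw [h3] at h2
  linarith

/-! ### The Sobolev embedding -/

-- The multiplication formula for the forward transform, carried to the inverse one by reflecting
-- `ξ`.
open FourierTransform in
theorem integral_fourierInv_mul {ψ : 𝓢(ℝ, ℂ)} {G : ℝ → ℂ} (hG : Integrable G) :
    ∫ ξ, (𝓕⁻ ψ) ξ * G ξ = ∫ x, ψ x * 𝓕⁻ G x := by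
  have h1 : ∀ ξ, (𝓕⁻ ψ) ξ = 𝓕 (ψ : ℝ → ℂ) (-ξ) := fun ξ => by
    rw [SchwartzMap.fourierInv_coe, Real.fourierInv_eq_fourier_neg]
  simp_rw [h1]
  rw [← integral_neg_eq_self, Real.fourierInv_eq_fourier_comp_neg]
  simp only [neg_neg]
  have := VectorFourier.integral_fourierIntegral_smul_eq_flip (μ := (volume : Measure ℝ))
    (ν := (volume : Measure ℝ)) (L := innerₗ ℝ) (e := Real.fourierChar) (f := (ψ : ℝ → ℂ))
    (g := fun ξ => G (-ξ)) Real.continuous_fourierChar continuous_inner ψ.integrable hG.comp_neg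
  simpa using! this

theorem norm_exp_sub_one_sub_le (θ : ℝ) :
    ‖Complex.exp (θ * Complex.I) - 1 - θ * Complex.I‖ ≤ 3 * θ ^ 2 := by
  rcases le_or_gt |θ| 1 with h | h
  · have := Complex.norm_exp_sub_one_sub_id_le (x := θ * Complex.I) (by simpa using h)
    simp at this
    nlinarith [sq_nonneg θ]
  · calc ‖Complex.exp (θ * Complex.I) - 1 - θ * Complex.I‖
        ≤ ‖Complex.exp (θ * Complex.I)‖ + ‖(1 : ℂ)‖ + ‖θ * Complex.I‖ :=
          (norm_sub_le _ _).trans (by gcongr; exact norm_sub_le _ _)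
      _ = 2 + |θ| := by rw [Complex.norm_exp_ofReal_mul_I]; simp; norm_num
      _ ≤ 3 * θ ^ 2 := by rw [← sq_abs]; nlinarith

-- The weight makes `|ξ|^k ‖G‖ ≤ ‖H‖` for `k = 0, 1, 2`, so one may differentiate under the
-- integral. The linear coefficient carries the factor `2πiξ`. The Taylor remainder of the phase, at
-- most `3 (2πξ(z - y))²`, yields the constant `12π²`.
open FourierTransform in
theorem quadraticBound_re_fourierInv {H : ℝ → ℂ} (hH : Integrable H) :
    QuadraticBound (∫ ξ, ‖H ξ‖) (12 * Real.pi ^ 2 * ∫ ξ, ‖H ξ‖)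
      fun x => (𝓕⁻ (fun ξ : ℝ => ((1 + ξ ^ 2)⁻¹ : ℝ) * H ξ) x).re := by
  set G : ℝ → ℂ := fun ξ : ℝ => ((1 + ξ ^ 2)⁻¹ : ℝ) * H ξ with hGdef
  have hw : ∀ ξ : ℝ, ‖(((1 + ξ ^ 2)⁻¹ : ℝ) : ℂ)‖ = (1 + ξ ^ 2)⁻¹ := fun ξ => by
    rw [Complex.norm_real, Real.norm_eq_abs, abs_of_nonneg (by positivity)]
  have hcw : Continuous fun ξ : ℝ => (((1 + ξ ^ 2)⁻¹ : ℝ) : ℂ) :=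
    Complex.continuous_ofReal.comp (Continuous.inv₀ (by fun_prop) fun ξ => by positivity)
  have hGn : ∀ ξ, ‖G ξ‖ ≤ ‖H ξ‖ := fun ξ => by
    rw [hGdef]; simp only [norm_mul, hw]
    exact mul_le_of_le_one_left (norm_nonneg _) (inv_le_one_of_one_le₀ (by nlinarith [sq_nonneg ξ]))
  have hGn2 : ∀ ξ, ξ ^ 2 * ‖G ξ‖ ≤ ‖H ξ‖ := fun ξ => by
    rw [hGdef]; simp only [norm_mul, hw]
    rw [← mul_assoc, ← div_eq_mul_inv]
    exact mul_le_of_le_one_left (norm_nonneg _) ((div_le_one₀ (by positivity)).2 (by linarith))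
  have hGn1 : ∀ ξ, |ξ| * ‖G ξ‖ ≤ ‖H ξ‖ := fun ξ => by
    rw [hGdef]; simp only [norm_mul, hw]
    rw [← mul_assoc, ← div_eq_mul_inv]
    exact mul_le_of_le_one_left (norm_nonneg _)
      ((div_le_one₀ (by positivity)).2 (by rw [← sq_abs]; nlinarith [sq_nonneg (|ξ| - 1)]))
  have hGm : AEStronglyMeasurable G := hcw.aestronglyMeasurable.mul hH.aestronglyMeasurable
  have hG : Integrable G := hH.norm.mono' hGm (.of_forall hGn)
  have hE : ∀ x, 𝓕⁻ G x = ∫ v, Complex.exp ((2 * Real.pi * v * x : ℝ) * Complex.I) * G v := fun x => by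
    rw [Real.fourierInv_eq']
    refine integral_congr_ae (.of_forall fun v => ?_)
    simp only [smul_eq_mul, RCLike.inner_apply, conj_trivial]
    congr 4; ring
  have hexp : ∀ x v : ℝ, ‖Complex.exp ((2 * Real.pi * v * x : ℝ) * Complex.I)‖ = 1 := fun x v =>
    Complex.norm_exp_ofReal_mul_I _
  have hm : ∀ x : ℝ, AEStronglyMeasurable fun v : ℝ =>
      Complex.exp ((2 * Real.pi * v * x : ℝ) * Complex.I) * G v := fun x =>
    (by fun_prop : Continuous fun v : ℝ =>
      Complex.exp ((2 * Real.pi * v * x : ℝ) * Complex.I)).aestronglyMeasurable.mul hGm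
  have hi : ∀ x : ℝ, Integrable fun v : ℝ =>
      Complex.exp ((2 * Real.pi * v * x : ℝ) * Complex.I) * G v := fun x =>
    hH.norm.mono' (hm x) (.of_forall fun v => by rw [norm_mul, hexp, one_mul]; exact hGn v)
  refine ⟨?_, fun x => ?_, fun y => (∫ v, (2 * Real.pi * v : ℝ) * Complex.I *
    (Complex.exp ((2 * Real.pi * v * y : ℝ) * Complex.I) * G v)).re, fun y z => ?_⟩
  · refine Complex.continuous_re.comp ?_
    rw [funext hE]
    refine continuous_of_dominated hm
      (fun x => .of_forall fun v => by rw [norm_mul, hexp, one_mul]; exact hGn v) hH.norm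
      (.of_forall fun v => by fun_prop)
  · refine (Complex.abs_re_le_norm _).trans ?_
    rw [hE]
    refine norm_integral_le_of_norm_le hH.norm (.of_forall fun v => ?_)
    rw [norm_mul, hexp, one_mul]; exact hGn v
  · have hi' : Integrable fun v : ℝ => (2 * Real.pi * v : ℝ) * Complex.I *
        (Complex.exp ((2 * Real.pi * y * v : ℝ) * Complex.I) * G v) := by
      refine (hH.norm.const_mul (2 * Real.pi)).mono' ?_ (.of_forall fun v => ?_)
      · simp_rw [mul_right_comm (2 * Real.pi) y]
        exact (by fun_prop : Continuous fun v : ℝ =>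
          ((2 * Real.pi * v : ℝ) : ℂ) * Complex.I).aestronglyMeasurable.mul (hm y)
      · rw [mul_right_comm (2 * Real.pi) y, norm_mul, norm_mul (Complex.exp _), hexp, one_mul,
          norm_mul, Complex.norm_I, mul_one, Complex.norm_real, Real.norm_eq_abs, abs_mul,
          abs_of_pos Real.two_pi_pos, mul_assoc]
        gcongr
        exact hGn1 v
    simp_rw [mul_right_comm (2 * Real.pi) y] at hi'
    have e : (𝓕⁻ G z).re - (𝓕⁻ G y).re - (∫ v, (2 * Real.pi * v : ℝ) * Complex.I *
        (Complex.exp ((2 * Real.pi * v * y : ℝ) * Complex.I) * G v)).re * (z - y) =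
        (∫ v, (Complex.exp ((2 * Real.pi * v * z : ℝ) * Complex.I) * G v
          - Complex.exp ((2 * Real.pi * v * y : ℝ) * Complex.I) * G v
          - (2 * Real.pi * v : ℝ) * Complex.I *
            (Complex.exp ((2 * Real.pi * v * y : ℝ) * Complex.I) * G v) * ((z - y : ℝ) : ℂ))).re := by
      have hi'' : Integrable fun v : ℝ => Complex.exp ((2 * Real.pi * v * z : ℝ) * Complex.I) * G v
          - Complex.exp ((2 * Real.pi * v * y : ℝ) * Complex.I) * G v := (hi z).sub (hi y)
      rw [integral_sub hi'' (hi'.mul_const _), integral_sub (hi z) (hi y),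
        integral_mul_const, hE, hE, Complex.sub_re, Complex.sub_re, Complex.re_mul_ofReal]
    rw [e]
    refine (Complex.abs_re_le_norm _).trans ?_
    rw [show 12 * Real.pi ^ 2 * (∫ ξ, ‖H ξ‖) * (z - y) ^ 2 =
      ∫ ξ, 12 * Real.pi ^ 2 * (z - y) ^ 2 * ‖H ξ‖ by rw [integral_const_mul]; ring]
    refine norm_integral_le_of_norm_le (hH.norm.const_mul _) (.of_forall fun v => ?_)
    have e2 : Complex.exp ((2 * Real.pi * v * z : ℝ) * Complex.I) =
        Complex.exp ((2 * Real.pi * v * (z - y) : ℝ) * Complex.I) *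
          Complex.exp ((2 * Real.pi * v * y : ℝ) * Complex.I) := by
      rw [← Complex.exp_add]; congr 1; push_cast; ring
    have e3 : Complex.exp ((2 * Real.pi * v * z : ℝ) * Complex.I) * G v
          - Complex.exp ((2 * Real.pi * v * y : ℝ) * Complex.I) * G v
          - (2 * Real.pi * v : ℝ) * Complex.I *
            (Complex.exp ((2 * Real.pi * v * y : ℝ) * Complex.I) * G v) * ((z - y : ℝ) : ℂ) =
        (Complex.exp ((2 * Real.pi * v * (z - y) : ℝ) * Complex.I) - 1
          - (2 * Real.pi * v * (z - y) : ℝ) * Complex.I) *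
        (Complex.exp ((2 * Real.pi * v * y : ℝ) * Complex.I) * G v) := by
      rw [e2]; push_cast; ring
    rw [e3, norm_mul, norm_mul, hexp, one_mul]
    calc _ ≤ 3 * (2 * Real.pi * v * (z - y)) ^ 2 * ‖G v‖ := by
          gcongr; exact norm_exp_sub_one_sub_le _
      _ = 12 * Real.pi ^ 2 * (z - y) ^ 2 * (v ^ 2 * ‖G v‖) := by ring
      _ ≤ _ := by gcongr; exact hGn2 v

theorem memLp_two_weight {r : ℝ} (hr : 1 < 2 * r) :
    MemLp (fun x : ℝ => (((1 + ‖x‖ ^ 2) ^ (-r / 2) : ℝ) : ℂ)) 2 := by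
  have hc : Continuous fun x : ℝ => (1 + ‖x‖ ^ 2) ^ (-r / 2) :=
    Continuous.rpow_const (by fun_prop) fun x => .inl (by positivity)
  have : MemLp (fun x : ℝ => (1 + ‖x‖ ^ 2) ^ (-r / 2)) 2 := by
    rw [memLp_two_iff_integrable_sq hc.aestronglyMeasurable]
    refine (integrable_rpow_neg_one_add_norm_sq (E := ℝ) (μ := volume) (r := 2 * r)
      (by simpa using hr)).congr (.of_forall fun x => ?_)
    simp only
    rw [← Real.rpow_mul_natCast (by positivity)]
    congr 1; push_cast; ring
  exact this.ofReal

open FourierTransform in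
/-- The Fourier transform of an element of `H^s(ℝ)`, `s > 5/2`, is integrable against `1 + |ξ|²`. -/
theorem Sobolev.exists_fourierInv {s : ℝ} (hs : 5 / 2 < s) : ∃ C : ℝ, 0 ≤ C ∧ ∀ g : Sobolev s,
    ∃ H : ℝ → ℂ, Integrable H ∧ ∫ ξ, ‖H ξ‖ ≤ C * ‖g‖ ∧
      complexify (Sobolev.toL2 s g) =ᵐ[volume]
        𝓕⁻ (fun ξ : ℝ => ((1 + ξ ^ 2)⁻¹ : ℝ) * H ξ) := by
  have h2 : MemLp (fun x : ℝ => (((1 + ‖x‖ ^ 2) ^ (-(s - 2) / 2) : ℝ) : ℂ)) 2 :=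
    memLp_two_weight (by linarith)
  have h0 : MemLp (fun x : ℝ => (((1 + ‖x‖ ^ 2) ^ (-s / 2) : ℝ) : ℂ)) 2 :=
    memLp_two_weight (by linarith)
  refine ⟨‖h2.toLp _‖, norm_nonneg _, fun g => ?_⟩
  set b := Sobolev.bessel s g
  -- With `b` the Bessel potential of `g`, the transform of `g` is `(1 + ξ²)^{-s/2}` times that of
  -- `b`, namely `G₁`. Multiplied by `1 + ξ²` it is `H`, integrable by Cauchy–Schwarz because `s - 2
  -- > 1/2`.
  set H : Lp ℂ 1 (volume : Measure ℝ) := h2.toLp _ • (𝓕 b : Lp ℂ 2 (volume : Measure ℝ)) with hH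
  set G₁ : Lp ℂ 1 (volume : Measure ℝ) := h0.toLp _ • (𝓕 b : Lp ℂ 2 (volume : Measure ℝ)) with hG₁
  have hHi : Integrable H := L1.integrable_coeFn H
  have hGH : (G₁ : ℝ → ℂ) =ᵐ[volume] fun ξ : ℝ => ((1 + ξ ^ 2)⁻¹ : ℝ) * H ξ := by
    filter_upwards [Lp.coeFn_lpSMul (r := 1) (h2.toLp _) (𝓕 b : Lp ℂ 2 (volume : Measure ℝ)),
      Lp.coeFn_lpSMul (r := 1) (h0.toLp _) (𝓕 b : Lp ℂ 2 (volume : Measure ℝ)),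
      h2.coeFn_toLp, h0.coeFn_toLp] with ξ e1 e2 e3 e4
    rw [hG₁, hH, e1, e2]
    simp only [Pi.smul_apply', e3, e4, smul_eq_mul]
    rw [← mul_assoc]
    congr 1
    norm_cast
    rw [← Real.rpow_neg_one, Real.norm_eq_abs, sq_abs, ← Real.rpow_add (by positivity)]
    congr 1; ring
  refine ⟨H, hHi, ?_, ?_⟩
  · rw [← L1.norm_eq_integral_norm, hH, Sobolev.norm_def, ← Lp.norm_fourier_eq b]
    exact Lp.norm_smul_le _ _
  set G : ℝ → ℂ := fun ξ : ℝ => ((1 + ξ ^ 2)⁻¹ : ℝ) * H ξ with hGdef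
  have hG : Integrable G := (L1.integrable_coeFn G₁).congr hGH
  have hT : Lp.toTemperedDistributionCLM ℂ volume 2 (complexify (Sobolev.toL2 s g)) =
      𝓕⁻ (Lp.toTemperedDistribution G₁) := by
    have h := congrArg (TemperedDistribution.besselPotential ℝ ℂ (-s)) (Sobolev.bessel_spec s g)
    rw [TemperedDistribution.besselPotential_besselPotential_apply, add_neg_cancel,
      TemperedDistribution.besselPotential_zero, ContinuousLinearMap.id_apply] at h
    rw [h, TemperedDistribution.besselPotential, TemperedDistribution.fourierMultiplierCLM_apply,
      Lp.toTemperedDistributionCLM_apply, Lp.fourier_toTemperedDistribution_eq, hG₁,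
      Lp.toTemperedDistribution_smul_eq (by fun_prop)]
  have hcont : Continuous (𝓕⁻ G) :=
    VectorFourier.fourierIntegral_continuous Real.continuous_fourierChar
      (by simp only [LinearMap.neg_apply, innerₗ_apply_apply]; fun_prop) hG
  have hloc : LocallyIntegrable (complexify (Sobolev.toL2 s g)) :=
    (Lp.memLp _).locallyIntegrable (by norm_num)
  -- The equality of tempered distributions, tested against smooth compactly supported functions,
  -- becomes an almost everywhere equality of functions.
  have := ae_eq_zero_of_integral_contDiff_smul_eq_zero (hloc.sub hcont.locallyIntegrable)
    fun ψ hψ hψ' => by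
      have hψc : ContDiff ℝ ∞ fun x => (ψ x : ℂ) := Complex.ofRealCLM.contDiff.comp hψ
      have hψc' : HasCompactSupport fun x => (ψ x : ℂ) := hψ'.comp_left Complex.ofReal_zero
      have h := congrArg (fun T => T (hψc'.toSchwartzMap hψc)) hT
      simp only [Lp.toTemperedDistributionCLM_apply, Lp.toTemperedDistribution_apply,
        TemperedDistribution.fourierInv_apply, smul_eq_mul] at h
      have h' : ∫ ξ, (𝓕⁻ (hψc'.toSchwartzMap hψc)) ξ * G₁ ξ =
          ∫ ξ, (𝓕⁻ (hψc'.toSchwartzMap hψc)) ξ * G ξ :=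
        integral_congr_ae (by filter_upwards [hGH] with ξ hξ; rw [hξ])
      rw [h', integral_fourierInv_mul hG] at h
      simp only [HasCompactSupport.toSchwartzMap_toFun] at h
      have i1 : Integrable fun x => ψ x • complexify (Sobolev.toL2 s g) x :=
        hloc.integrable_smul_left_of_hasCompactSupport hψ.continuous hψ'
      have i2 : Integrable fun x => ψ x • 𝓕⁻ G x :=
        hcont.locallyIntegrable.integrable_smul_left_of_hasCompactSupport hψ.continuous hψ'
      simp only [Pi.sub_apply, smul_sub]
      rw [integral_sub i1 i2, sub_eq_zero]
      simpa using h
  filter_upwards [this] with x hx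
  simpa [sub_eq_zero] using hx

/-- Since `g` is real, the real part of the Fourier integral is its continuous representative. The
factor `1 + 12π²` covers both the sup bound and the Taylor bound. -/
theorem Sobolev.exists_quadraticBound {s : ℝ} (hs : 5 / 2 < s) : ∃ C : ℝ, 0 ≤ C ∧
    ∀ g : Sobolev s, QuadraticBound (C * ‖g‖) (C * ‖g‖) g.fn ∧
      g.fn =ᵐ[volume] Sobolev.toL2 s g := by
  obtain ⟨C, hC, H⟩ := Sobolev.exists_fourierInv hs
  refine ⟨(1 + 12 * Real.pi ^ 2) * C, by positivity, fun g => ?_⟩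
  obtain ⟨F, hF, hFn, hFe⟩ := H g
  have hQ := quadraticBound_re_fourierInv hF
  have hae : (fun x => (FourierTransform.fourierInv (fun ξ : ℝ => ((1 + ξ ^ 2)⁻¹ : ℝ) * F ξ) x).re)
      =ᵐ[volume] Sobolev.toL2 s g := by
    filter_upwards [hFe, Complex.ofRealCLM.coeFn_compLpL (p := 2) (Sobolev.toL2 s g)] with x h1 h2
    rw [← h1]
    rw [complexify, h2]; simp
  have hfn : g.fn = _ := contRep_eq hQ.continuous hae
  rw [hfn]
  have hF0 : 0 ≤ C * ‖g‖ := by positivity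
  refine ⟨⟨hQ.continuous, fun x => (hQ.bound x).trans ?_, ?_⟩, hae⟩
  · nlinarith [sq_nonneg Real.pi]
  · obtain ⟨D, hD⟩ := hQ.quadratic
    refine ⟨D, fun y z => (hD y z).trans ?_⟩
    refine mul_le_mul_of_nonneg_right ?_ (sq_nonneg _)
    nlinarith [mul_le_mul_of_nonneg_left hFn (sq_nonneg Real.pi)]

theorem Sobolev.fn_add {s : ℝ} (hs : 5 / 2 < s) (g k : Sobolev s) :
    (g + k).fn = g.fn + k.fn := by
  obtain ⟨C, -, H⟩ := Sobolev.exists_quadraticBound hs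
  refine contRep_eq ((H g).1.continuous.add (H k).1.continuous) ?_
  rw [map_add]
  exact ((H g).2.add (H k).2).trans (Lp.coeFn_add _ _).symm

theorem Sobolev.fn_smul {s : ℝ} (hs : 5 / 2 < s) (c : ℝ) (g : Sobolev s) :
    (c • g).fn = c • g.fn := by
  obtain ⟨C, -, H⟩ := Sobolev.exists_quadraticBound hs
  refine contRep_eq ((H g).1.continuous.const_smul c) ?_
  rw [map_smul]
  exact ((H g).2.const_smul c).trans (Lp.coeFn_smul _ _).symm

/-! ### Autonomous ordinary differential equations -/

theorem isOpen_coe_lt (S : EReal) : IsOpen {t : ℝ | (t : EReal) < S} :=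
  isOpen_Iio.preimage continuous_coe_real_ereal

theorem timeInterval_mem_nhdsWithin {S : EReal} {t : ℝ} (ht : t ∈ timeInterval S) :
    timeInterval S ∈ nhdsWithin t (Ici 0) :=
  Filter.inter_mem self_mem_nhdsWithin (mem_nhdsWithin_of_mem_nhds ((isOpen_coe_lt S).mem_nhds ht.2))

theorem uniqueDiffOn_timeInterval (S : EReal) : UniqueDiffOn ℝ (timeInterval S) :=
  (uniqueDiffOn_Ici 0).inter (isOpen_coe_lt S)

/-- `[0, S)` is relatively open in `[0, ∞)`, so derivatives do not see `S`. Solutions on different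
intervals can then be compared and glued. -/
theorem hasDerivWithinAt_timeInterval_iff {E : Type*} [NormedAddCommGroup E] [NormedSpace ℝ E]
    {v : ℝ → E} {v' : E} {S : EReal} {t : ℝ} (ht : t ∈ timeInterval S) :
    HasDerivWithinAt v v' (timeInterval S) t ↔ HasDerivWithinAt v v' (Ici 0) t :=
  hasDerivWithinAt_inter ((isOpen_coe_lt S).mem_nhds ht.2)

section ODE

variable {E : Type*} [NormedAddCommGroup E] [NormedSpace ℝ E]

/-- `v` solves `v' = G v` on `[0, S)` with initial value `x₀`. -/
def SolvesODE (G : E → E) (x₀ : E) (S : EReal) (v : ℝ → E) : Prop :=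
  v 0 = x₀ ∧ ∀ t ∈ timeInterval S, HasDerivWithinAt v (G (v t)) (Ici 0) t

theorem SolvesODE.continuousOn {G : E → E} {x₀ : E} {S : EReal} {v : ℝ → E}
    (hv : SolvesODE G x₀ S v) {t : ℝ} (ht : t ∈ timeInterval S) : ContinuousOn v (Icc 0 t) :=
  fun r hr => (hv.2 r ⟨hr.1, (EReal.coe_le_coe_iff.2 hr.2).trans_lt ht.2⟩).continuousWithinAt.mono
    Icc_subset_Ici_self

/-- On the compact interval `[0, t]` both solutions stay in a common ball, on which the field is
Lipschitz. -/
theorem SolvesODE.eq {G : E → E} {x₀ : E}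
    (hG : ∀ R : ℝ, ∃ K, LipschitzOnWith K G (Metric.closedBall 0 R)) {S S' : EReal} {v w : ℝ → E}
    (hv : SolvesODE G x₀ S v) (hw : SolvesODE G x₀ S' w) {t : ℝ} (ht : t ∈ timeInterval S)
    (ht' : t ∈ timeInterval S') : v t = w t := by
  obtain ⟨R₁, hR₁⟩ := isCompact_Icc.exists_bound_of_continuousOn (hv.continuousOn ht)
  obtain ⟨R₂, hR₂⟩ := isCompact_Icc.exists_bound_of_continuousOn (hw.continuousOn ht')
  obtain ⟨K, hK⟩ := hG (max R₁ R₂)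
  have hd : ∀ {S : EReal} {v : ℝ → E}, SolvesODE G x₀ S v → t ∈ timeInterval S →
      ∀ r ∈ Ico 0 t, HasDerivWithinAt v (G (v r)) (Ici r) r := fun hv ht r hr =>
    (hv.2 r ⟨hr.1, (EReal.coe_le_coe_iff.2 hr.2.le).trans_lt ht.2⟩).mono (Ici_subset_Ici.2 hr.1)
  exact ODE_solution_unique_of_mem_Icc_right (v := fun _ => G)
    (s := fun _ => Metric.closedBall 0 (max R₁ R₂)) (fun _ _ => hK) (hv.continuousOn ht) (hd hv ht)
    (fun r hr => by simpa using .inl (hR₁ r ⟨hr.1, hr.2.le⟩))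
    (hw.continuousOn ht') (hd hw ht')
    (fun r hr => by simpa using .inr (hR₂ r ⟨hr.1, hr.2.le⟩))
    (hv.1.trans hw.1.symm) ⟨ht.1, le_rfl⟩

/-- A locally solvable initial value problem has a solution of maximal existence time. -/
theorem SolvesODE.exists_maximal {G : E → E} {x₀ : E}
    (hG : ∀ R : ℝ, ∃ K, LipschitzOnWith K G (Metric.closedBall 0 R)) {S₀ : EReal} (hS₀ : 0 < S₀)
    {v₀ : ℝ → E} (hv₀ : SolvesODE G x₀ S₀ v₀) :
    ∃ S v, 0 < S ∧ SolvesODE G x₀ S v ∧ ∀ S' w, S < S' → ¬ SolvesODE G x₀ S' w := by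
  classical
  let A : Set EReal := {S | ∃ w, SolvesODE G x₀ S w}
  let P : ℝ → (EReal × (ℝ → E)) → Prop := fun t p => (t : EReal) < p.1 ∧ SolvesODE G x₀ p.1 p.2
  -- At each time `v` takes the value of some solution still alive; by uniqueness the choice does
  -- not matter, so `v` glues all solutions up to the supremum of existence times.
  let v : ℝ → E := fun t => if h : ∃ p, P t p then h.choose.2 t else 0
  have hle : S₀ ≤ sSup A := le_sSup ⟨v₀, hv₀⟩
  have hvw : ∀ {S : EReal} {w : ℝ → E}, SolvesODE G x₀ S w → ∀ t ∈ timeInterval S, v t = w t := by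
    intro S w hw t ht
    have h : ∃ p, P t p := ⟨(S, w), ht.2, hw⟩
    simp only [v, dif_pos h]
    exact h.choose_spec.2.eq hG hw ⟨ht.1, h.choose_spec.1⟩ ht
  refine ⟨sSup A, v, hS₀.trans_le hle, ⟨?_, fun t ht => ?_⟩, fun S' w hS' hw => ?_⟩
  · rw [hvw hv₀ 0 ⟨le_rfl, by simpa using hS₀⟩, hv₀.1]
  · obtain ⟨S, ⟨w, hw⟩, hS⟩ := lt_sSup_iff.1 ht.2
    have htS : t ∈ timeInterval S := ⟨ht.1, hS⟩
    rw [hvw hw t htS]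
    refine (hw.2 t htS).congr_of_eventuallyEq ?_ (hvw hw t htS)
    filter_upwards [timeInterval_mem_nhdsWithin htS] with r hr using hvw hw r hr
  · exact (le_sSup (show S' ∈ A from ⟨w, hw⟩)).not_gt hS'

/-- A vector field that is Lipschitz continuous and bounded has global solutions. -/
theorem exists_hasDerivWithinAt_of_lipschitz [CompleteSpace E] {G : E → E} {K L : NNReal}
    (hK : LipschitzWith K G) (hL : ∀ x, ‖G x‖ ≤ L) (x₀ : E) {b : ℝ} (hb : 0 ≤ b) :
    ∃ v : ℝ → E, v 0 = x₀ ∧ ∀ t ∈ Icc 0 b, HasDerivWithinAt v (G (v t)) (Icc 0 b) t := by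
  -- A field bounded by `L` moves a point by at most `L * b` in time `b`; with that radius
  -- Picard–Lindelöf needs no smallness of `b`.
  have : IsPicardLindelof (fun _ => G) (⟨0, le_rfl, hb⟩ : Icc (0 : ℝ) b) x₀ (L * b.toNNReal) 0 L K :=
    ⟨fun _ _ => hK.lipschitzOnWith, fun _ _ => continuousOn_const, fun _ _ x _ => hL x, by
      simp [hb]⟩
  exact this.exists_eq_forall_mem_Icc_hasDerivWithinAt₀

/-- With equal initial data the Gronwall bound is linear in the defect, so a defect `E * h ^ 2`
gives an error of the same order. -/
theorem gronwallBound_zero_eq_mul (K ε x : ℝ) :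
    gronwallBound 0 K ε x = gronwallBound 0 K 1 x * ε := by
  unfold gronwallBound
  split_ifs <;> ring

theorem gronwallBound_nonneg {K ε x : ℝ} (hK : 0 ≤ K) (hε : 0 ≤ ε) (hx : 0 ≤ x) :
    0 ≤ gronwallBound 0 K ε x := by
  have := gronwallBound_mono le_rfl hε hK hx
  rwa [gronwallBound_x0] at this

theorem hasDerivWithinAt_Ici_of_Icc {v : ℝ → E} {v' : E} {b t : ℝ}
    (h : HasDerivWithinAt v v' (Icc 0 b) t) (ht : t ∈ Ico 0 b) :
    HasDerivWithinAt v v' (Ici 0) t := by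
  rw [← Ici_inter_Iic] at h
  exact (hasDerivWithinAt_inter (Iic_mem_nhds ht.2)).1 h

/-- An approximate solution in the interior of a ball where the field is Lipschitz is followed by
an exact solution. -/
theorem exists_solvesODE_of_approx [CompleteSpace E] {G : E → E} {K : NNReal} {R : ℝ} (hR : 0 ≤ R)
    (hG : LipschitzOnWith K G (Metric.closedBall 0 R)) {c : E → E} (hc : LipschitzWith 1 c)
    (hcR : ∀ x, c x ∈ Metric.closedBall (0 : E) R) (hc' : ∀ x ∈ Metric.closedBall (0 : E) R, c x = x)
    {T ε : ℝ} (hT : 0 < T) {U U' : ℝ → E}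
    (hU : ∀ t ∈ Icc 0 T, HasDerivWithinAt U (U' t) (Icc 0 T) t)
    (hε : ∀ t ∈ Icc 0 T, ‖U' t - G (U t)‖ ≤ ε) (hUR : ∀ t ∈ Icc 0 T, ‖U t‖ ≤ R - 1)
    (hg : gronwallBound 0 K ε T ≤ 1 / 2) :
    ∃ S : EReal, (T : EReal) < S ∧ ∃ v, SolvesODE G (U 0) S v ∧
      ∀ t ∈ Icc 0 T, ‖v t - U t‖ ≤ gronwallBound 0 K ε T := by
  have hε0 : 0 ≤ ε := (norm_nonneg _).trans (hε 0 ⟨le_rfl, hT.le⟩)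
  -- Composed with the retraction `c`, the field is globally Lipschitz and bounded, so it can be
  -- solved up to `T + 1`.
  have hGc : LipschitzWith K fun x => G (c x) := by
    have := hG.comp (g := G) (hc.lipschitzOnWith (s := univ)) fun x _ => hcR x
    rw [mul_one, lipschitzOnWith_univ] at this
    exact this
  have h0 : (0 : E) ∈ Metric.closedBall (0 : E) R := by simpa using hR
  obtain ⟨L, hL⟩ : ∃ L : NNReal, ∀ x, ‖G (c x)‖ ≤ L := by
    refine ⟨‖G 0‖₊ + K * R.toNNReal, fun x => ?_⟩
    have h1 := hG.dist_le_mul _ (hcR x) _ h0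
    have h2 : dist (c x) 0 ≤ R := hcR x
    have h3 := norm_le_norm_add_norm_sub' (G (c x)) (G 0)
    rw [dist_eq_norm] at h1
    push_cast
    rw [Real.coe_toNNReal _ hR]
    calc ‖G (c x)‖ ≤ ‖G 0‖ + K * dist (c x) 0 := by linarith
      _ ≤ _ := by gcongr
  obtain ⟨v, hv0, hv⟩ := exists_hasDerivWithinAt_of_lipschitz hGc hL (U 0)
    (show 0 ≤ T + 1 by linarith)
  have hcont : ContinuousOn v (Icc 0 (T + 1)) := fun t ht => (hv t ht).continuousWithinAt
  have hsub : Icc 0 T ⊆ Icc 0 (T + 1) := Icc_subset_Icc_right (by linarith)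
  have hUball : ∀ t ∈ Icc 0 T, U t ∈ Metric.closedBall (0 : E) R := fun t ht => by
    have := hUR t ht
    simp only [mem_closedBall_zero_iff]; linarith
  have hclose : ∀ t ∈ Icc 0 T, ‖v t - U t‖ ≤ gronwallBound 0 K ε T := fun t ht => by
    have := dist_le_of_approx_trajectories_ODE (v := fun _ x => G (c x)) (K := K) (f := v) (g := U)
      (f' := fun t => G (c (v t))) (g' := U') (a := 0) (b := T) (εf := 0) (εg := ε) (δ := 0)
      (fun _ => hGc) (hcont.mono hsub)
      (fun t ht => (hasDerivWithinAt_Ici_of_Icc (hv t (hsub ⟨ht.1, ht.2.le⟩)) ⟨ht.1, by linarith [ht.2]⟩).mono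
        (Ici_subset_Ici.2 ht.1))
      (fun t _ => by simp)
      (fun t ht => (hU t ht).continuousWithinAt)
      (fun t ht => (hasDerivWithinAt_Ici_of_Icc (hU t ⟨ht.1, ht.2.le⟩) ht).mono (Ici_subset_Ici.2 ht.1))
      (fun t ht => by
        have ht' : t ∈ Icc 0 T := ⟨ht.1, ht.2.le⟩
        rw [dist_eq_norm, hc' _ (hUball t ht')]
        exact hε t ht')
      (by rw [hv0, dist_self]) t ht
    rw [dist_eq_norm, sub_zero, zero_add] at this
    exact this.trans (gronwallBound_mono le_rfl hε0 K.2 ht.2)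
  -- The curve `U` keeps distance 1 from the sphere and the error uses at most half of it. By
  -- continuity `v` stays in the ball slightly beyond `T`, where `c` is the identity and `v` solves
  -- the original equation.
  have hnorm : ∀ t ∈ Icc 0 T, ‖v t‖ ≤ R - 1 / 2 := fun t ht => by
    have h1 := hclose t ht
    have h2 := hUR t ht
    have h3 := norm_le_norm_add_norm_sub' (v t) (U t)
    linarith
  obtain ⟨δ, hδ, hδR⟩ : ∃ δ > 0, ∀ t ∈ Icc 0 (T + 1), |t - T| < δ → ‖v t‖ ≤ R := by
    have hTm : T ∈ Icc 0 (T + 1) := hsub ⟨hT.le, le_rfl⟩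
    obtain ⟨δ, hδ, H⟩ := Metric.continuousWithinAt_iff.1 (hcont T hTm) (1 / 2) (by norm_num)
    refine ⟨δ, hδ, fun t ht h => ?_⟩
    have h1 := H ht h
    have h2 := hnorm T ⟨hT.le, le_rfl⟩
    have h3 := norm_le_norm_add_norm_sub' (v t) (v T)
    rw [dist_eq_norm] at h1
    linarith
  refine ⟨((T + min δ 1 : ℝ) : EReal), ?_, v, ⟨hv0, fun t ht => ?_⟩, hclose⟩
  · have : 0 < min δ 1 := by positivity
    exact EReal.coe_lt_coe_iff.2 (by linarith)
  · have ht1 : t < T + min δ 1 := EReal.coe_lt_coe_iff.1 ht.2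
    have ht2 : t ∈ Ico 0 (T + 1) := ⟨ht.1, by linarith [min_le_right δ 1]⟩
    have hvt : ‖v t‖ ≤ R := by
      rcases le_or_gt t T with h | h
      · linarith [hnorm t ⟨ht.1, h⟩]
      · exact hδR t ⟨ht2.1, ht2.2.le⟩ (by rw [abs_of_pos (by linarith)]; linarith [min_le_left δ 1])
    have := hasDerivWithinAt_Ici_of_Icc (hv t ⟨ht2.1, ht2.2.le⟩) ht2
    rwa [hc' (v t) (by simpa using hvt)] at this

end ODE

/-! ### Bounded sequences -/

/-- The space of bounded sequences indexed by the grid. -/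
abbrev GridSpace : Type := lp (fun _ : ℤ => ℝ) ∞

theorem memℓp_infty_of_forall {w : ℤ → ℝ} {C : ℝ} (h : ∀ i, |w i| ≤ C) :
    Memℓp (E := fun _ : ℤ => ℝ) w ∞ :=
  memℓp_infty ⟨C, by rintro _ ⟨i, rfl⟩; exact h i⟩

theorem GridSpace.abs_apply_le (v : GridSpace) (i : ℤ) : |v i| ≤ ‖v‖ :=
  lp.norm_apply_le_norm ENNReal.top_ne_zero v i

theorem GridSpace.norm_le {v : GridSpace} {C : ℝ} (hC : 0 ≤ C) (h : ∀ i, |v i| ≤ C) : ‖v‖ ≤ C :=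
  lp.norm_le_of_forall_le hC h

theorem summable_conv {k : ℤ → ℝ} (hk : Summable fun i => |k i|) {w : ℤ → ℝ} {B : ℝ} (hw : ∀ i, |w i| ≤ B) (i : ℤ) :
    Summable fun j => k (i - j) * w j := by
  have : Summable fun j => |k (i - j)| := (Equiv.subLeft i).summable_iff.2 hk
  refine Summable.of_norm_bounded (this.mul_right B) fun j => ?_
  rw [Real.norm_eq_abs, abs_mul]
  gcongr
  exact hw j

theorem abs_tsum_conv_le {k : ℤ → ℝ} (hk : Summable fun i => |k i|) {w : ℤ → ℝ} {B : ℝ} (hw : ∀ i, |w i| ≤ B) (i : ℤ) :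
    |∑' j, k (i - j) * w j| ≤ (∑' j, |k j|) * B := by
  have hs : Summable fun j => |k (i - j)| := (Equiv.subLeft i).summable_iff.2 hk
  rw [← (Equiv.subLeft i).tsum_eq fun j => |k j|, ← tsum_mul_right]
  refine tsum_of_norm_bounded (f := fun j => k (i - j) * w j) (hs.mul_right B).hasSum fun j => ?_
  rw [Real.norm_eq_abs, abs_mul]
  gcongr
  exact hw j

/-- Convolution with a summable sequence, as an operator on bounded sequences. -/
noncomputable def convCLM (k : ℤ → ℝ) (hk : Summable fun i => |k i|) : GridSpace →L[ℝ] GridSpace :=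
  LinearMap.mkContinuous
    { toFun := fun v => ⟨fun i => ∑' j, k (i - j) * v j,
        memℓp_infty_of_forall (abs_tsum_conv_le hk v.abs_apply_le)⟩
      map_add' := fun v w => by
        ext i
        simp only [lp.coeFn_add, Pi.add_apply, mul_add]
        exact (summable_conv hk v.abs_apply_le i).tsum_add (summable_conv hk w.abs_apply_le i)
      map_smul' := fun c v => by
        ext i
        simp only [lp.coeFn_smul, Pi.smul_apply, smul_eq_mul, RingHom.id_apply, ← tsum_mul_left]
        congr 1; ext j; ring }
    (∑' j, |k j|) fun v => GridSpace.norm_le (by positivity) (abs_tsum_conv_le hk v.abs_apply_le)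

theorem norm_convCLM_le (k : ℤ → ℝ) (hk : Summable fun i => |k i|) :
    ‖convCLM k hk‖ ≤ ∑' j, |k j| :=
  LinearMap.mkContinuous_norm_le _ (by positivity) _

theorem exists_abs_comp_le {f : ℝ → ℝ} (hf : Continuous f) (v : GridSpace) :
    ∃ C, ∀ i, |f (v i)| ≤ C := by
  obtain ⟨C, hC⟩ := isCompact_Icc.exists_bound_of_continuousOn (s := Icc (-‖v‖) ‖v‖) hf.continuousOn
  exact ⟨C, fun i => hC _ (abs_le.1 (v.abs_apply_le i))⟩

/-- The superposition operator `v ↦ (f (v i))_i`. -/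
def superposition (f : ℝ → ℝ) (hf : Continuous f) (v : GridSpace) : GridSpace :=
  ⟨fun i => f (v i), memℓp_infty_of_forall (exists_abs_comp_le hf v).choose_spec⟩

theorem superposition_apply (f : ℝ → ℝ) (hf : Continuous f) (v : GridSpace) (i : ℤ) :
    superposition f hf v i = f (v i) := rfl

theorem lipschitzOnWith_superposition {f : ℝ → ℝ} (hf : Continuous f) {R : ℝ} {L : NNReal}
    (hL : LipschitzOnWith L f (Icc (-R) R)) :
    LipschitzOnWith L (superposition f hf) (Metric.closedBall 0 R) := by
  refine LipschitzOnWith.of_dist_le_mul fun v hv w hw => ?_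
  rw [mem_closedBall_zero_iff] at hv hw
  rw [dist_eq_norm, dist_eq_norm]
  refine GridSpace.norm_le (by positivity) fun i => ?_
  have := hL.dist_le_mul _ (abs_le.1 ((v.abs_apply_le i).trans hv)) _
    (abs_le.1 ((w.abs_apply_le i).trans hw))
  rw [Real.dist_eq, Real.dist_eq] at this
  simp only [lp.coeFn_sub, Pi.sub_apply, superposition_apply]
  exact this.trans (by gcongr; exact (v - w).abs_apply_le i)

/-- Componentwise truncation at height `R`. -/
def truncate (R : ℝ) : GridSpace → GridSpace :=
  superposition (fun x => max (-R) (min R x)) (by fun_prop)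

/-- Clamping is 1-Lipschitz in each coordinate, hence in the sup norm, so truncation leaves the
Lipschitz constant of the field unchanged. -/
theorem lipschitzWith_truncate (R : ℝ) : LipschitzWith 1 (truncate R) := by
  have h1 : LipschitzWith 1 fun x : ℝ => max (-R) (min R x) :=
    (LipschitzWith.id.const_min R).const_max (-R)
  refine LipschitzWith.of_dist_le_mul fun v w => ?_
  have h2 := lipschitzOnWith_superposition (R := max ‖v‖ ‖w‖)
    (by fun_prop : Continuous fun x : ℝ => max (-R) (min R x)) h1.lipschitzOnWith
  exact h2.dist_le_mul v (by simp) w (by simp)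

theorem truncate_mem {R : ℝ} (hR : 0 ≤ R) (v : GridSpace) :
    truncate R v ∈ Metric.closedBall (0 : GridSpace) R := by
  rw [mem_closedBall_zero_iff]
  refine GridSpace.norm_le hR fun i => abs_le.2 ⟨le_max_left _ _, max_le (by linarith) ?_⟩
  exact min_le_left _ _

theorem truncate_eq_self {R : ℝ} {v : GridSpace} (hv : v ∈ Metric.closedBall (0 : GridSpace) R) :
    truncate R v = v := by
  rw [mem_closedBall_zero_iff] at hv
  ext i
  have := abs_le.1 ((v.abs_apply_le i).trans hv)
  simp only [truncate, superposition_apply]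
  rw [min_eq_right this.2, max_eq_right this.1]

/-! ### The semi-discrete problem as an ordinary differential equation -/

/-- The vector field `v ↦ -k₁ ∗ f(v) - κ k₂ ∗ v`. -/
noncomputable def gridField (κ : ℝ) {f : ℝ → ℝ} (hf : Continuous f) {k₁ k₂ : ℤ → ℝ}
    (h₁ : Summable fun i => |k₁ i|) (h₂ : Summable fun i => |k₂ i|) (v : GridSpace) : GridSpace :=
  -convCLM k₁ h₁ (superposition f hf v) - κ • convCLM k₂ h₂ v

theorem gridField_apply (κ : ℝ) {f : ℝ → ℝ} (hf : Continuous f) {k₁ k₂ : ℤ → ℝ}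
    (h₁ : Summable fun i => |k₁ i|) (h₂ : Summable fun i => |k₂ i|) (v : GridSpace) (i : ℤ) :
    gridField κ hf h₁ h₂ v i =
      -(∑' j, k₁ (i - j) * f (v j)) - κ * ∑' j, k₂ (i - j) * v j := rfl

/-- The constant is expressed through upper bounds `A₁`, `A₂` for the `ℓ¹` norms of the kernels, so
that it can be taken independent of the mesh. -/
theorem lipschitzOnWith_gridField {κ : ℝ} (hκ : 0 ≤ κ) {f : ℝ → ℝ} (hf : Continuous f)
    {k₁ k₂ : ℤ → ℝ} (h₁ : Summable fun i => |k₁ i|) (h₂ : Summable fun i => |k₂ i|) {R : ℝ}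
    {L : NNReal} (hL : LipschitzOnWith L f (Icc (-R) R)) {A₁ A₂ : ℝ} (hA₁ : ∑' i, |k₁ i| ≤ A₁)
    (hA₂ : ∑' i, |k₂ i| ≤ A₂) :
    LipschitzOnWith (A₁ * L + κ * A₂).toNNReal (gridField κ hf h₁ h₂) (Metric.closedBall 0 R) := by
  refine LipschitzOnWith.of_dist_le_mul fun v hv w hw => ?_
  have hA₁0 : 0 ≤ A₁ := le_trans (by positivity) hA₁
  have hA₂0 : 0 ≤ A₂ := le_trans (by positivity) hA₂
  rw [Real.coe_toNNReal _ (by positivity), dist_eq_norm]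
  have e : gridField κ hf h₁ h₂ v - gridField κ hf h₁ h₂ w =
      -(convCLM k₁ h₁ (superposition f hf v - superposition f hf w)
        + κ • convCLM k₂ h₂ (v - w)) := by
    simp only [gridField, map_sub, smul_sub]; abel
  rw [e, norm_neg]
  have hsup := (lipschitzOnWith_superposition hf hL).dist_le_mul v hv w hw
  rw [dist_eq_norm] at hsup
  calc _ ≤ ‖convCLM k₁ h₁ (superposition f hf v - superposition f hf w)‖
        + ‖κ • convCLM k₂ h₂ (v - w)‖ := norm_add_le _ _
    _ ≤ A₁ * (L * dist v w) + κ * (A₂ * dist v w) := by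
        rw [norm_smul, Real.norm_eq_abs, abs_of_nonneg hκ]
        gcongr
        · exact (ContinuousLinearMap.le_opNorm _ _).trans (by
            gcongr; exact (norm_convCLM_le _ _).trans hA₁)
        · rw [dist_eq_norm]
          exact (ContinuousLinearMap.le_opNorm _ _).trans (by
            gcongr; exact (norm_convCLM_le _ _).trans hA₂)
    _ = _ := by ring

/-- An element of `ℓ^∞` is determined by its coordinates, and `C¹` regularity is automatic because
the field is continuous along a continuous curve. -/
theorem isSemidiscreteSolution_iff {α f : ℝ → ℝ} {κ h : ℝ} (hf : Continuous f)
    (h₁ : Summable fun i : ℤ => |h * gridRestrict h (kernelDeriv α) i|)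
    (h₂ : Summable fun i : ℤ => |h * secondDiff h (gridRestrict h (kernelDeriv α)) i|)
    (hloc : ∀ R : ℝ, ∃ K, LipschitzOnWith K (gridField κ hf h₁ h₂) (Metric.closedBall 0 R))
    (x₀ : GridSpace) (S : EReal) (v : ℝ → GridSpace) :
    IsSemidiscreteSolution α f κ h x₀ S v ↔ SolvesODE (gridField κ hf h₁ h₂) x₀ S v := by
  have hfield : ∀ (w : GridSpace) (i : ℤ), gridField κ hf h₁ h₂ w i =
      -discreteConv h (gridRestrict h (kernelDeriv α)) (fun j => f (w j)) i
      - κ * discreteConv h (secondDiff h (gridRestrict h (kernelDeriv α))) (fun j => w j) i :=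
    fun w i => rfl
  have hu := uniqueDiffOn_timeInterval S
  constructor
  · intro H
    refine ⟨lp.ext (funext H.initial), fun t ht => ?_⟩
    have hd := (H.contDiffOn.differentiableOn one_ne_zero t ht).hasDerivWithinAt
    have he : derivWithin v (timeInterval S) t = gridField κ hf h₁ h₂ (v t) :=
      lp.ext (funext fun i => (H.equation t ht i).trans (hfield (v t) i).symm)
    rw [he] at hd
    exact (hasDerivWithinAt_timeInterval_iff ht).1 hd
  · intro H
    have hd : ∀ t ∈ timeInterval S,
        HasDerivWithinAt v (gridField κ hf h₁ h₂ (v t)) (timeInterval S) t := fun t ht =>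
      (hasDerivWithinAt_timeInterval_iff ht).2 (H.2 t ht)
    have he : ∀ t ∈ timeInterval S,
        derivWithin v (timeInterval S) t = gridField κ hf h₁ h₂ (v t) := fun t ht =>
      (hd t ht).derivWithin (hu t ht)
    have hcG : Continuous (gridField κ hf h₁ h₂) := continuous_iff_continuousAt.2 fun x => by
      obtain ⟨K, hK⟩ := hloc (‖x‖ + 1)
      exact hK.continuousOn.continuousAt (Metric.closedBall_mem_nhds_of_mem (by simp))
    refine ⟨(contDiffOn_one_iff_derivWithin hu).2
      ⟨fun t ht => (hd t ht).differentiableWithinAt, ?_⟩, fun i => by rw [H.1],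
      fun t ht i => by rw [he t ht]; exact hfield (v t) i⟩
    have hcv : ContinuousOn v (timeInterval S) := fun t ht => (hd t ht).continuousWithinAt
    exact (hcG.comp_continuousOn hcv).congr he

/-! ### Consistency of the semi-discretization -/

theorem QuadraticBound.mono {B M B' M' : ℝ} {W : ℝ → ℝ} (hW : QuadraticBound B M W) (hB : B ≤ B')
    (hM : M ≤ M') : QuadraticBound B' M' W := by
  obtain ⟨D, hD⟩ := hW.quadratic
  exact ⟨hW.continuous, fun x => (hW.bound x).trans hB, D, fun y z => (hD y z).trans (by gcongr)⟩

/-- Mean value inequality for `x ↦ f x - f'(a) x`, whose derivative is at most `L |b - a|` between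
`a` and `b` since `f'` is Lipschitz there. -/
theorem exists_abs_sub_sub_deriv_mul_le {f : ℝ → ℝ} (hf : ContDiff ℝ 2 f) (R : ℝ) :
    ∃ L : ℝ, 0 ≤ L ∧ ∀ a ∈ Icc (-R) R, ∀ b ∈ Icc (-R) R,
      |f b - f a - deriv f a * (b - a)| ≤ L * (b - a) ^ 2 := by
  have hf' : ContDiff ℝ 1 (deriv f) := (contDiff_succ_iff_deriv.1 hf).2.2
  obtain ⟨L, hL⟩ := hf'.contDiffOn.exists_lipschitzOnWith one_ne_zero (convex_Icc (-R) R)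
    isCompact_Icc
  refine ⟨L, L.2, fun a ha b hb => ?_⟩
  have hd : ∀ x, HasDerivAt (fun x => f x - deriv f a * x) (deriv f x - deriv f a) x := fun x => by
    have := ((hf.differentiable two_ne_zero x).hasDerivAt).fun_sub
      ((hasDerivAt_id x).const_mul (deriv f a))
    rwa [mul_one] at this
  have hsub : uIcc a b ⊆ Icc (-R) R := (convex_Icc (-R) R).ordConnected.uIcc_subset ha hb
  have := (convex_uIcc a b).norm_image_sub_le_of_norm_hasDerivWithin_le (C := L * |b - a|)
    (fun x _ => (hd x).hasDerivWithinAt) (fun x hx => by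
      refine (hL.dist_le_mul x (hsub hx) a ha).trans ?_
      gcongr
      exact abs_sub_left_of_mem_uIcc hx) left_mem_uIcc right_mem_uIcc
  rw [Real.norm_eq_abs, Real.norm_eq_abs, mul_assoc, ← sq, sq_abs] at this
  convert this using 2
  ring

/-- A quantitative chain rule. The new constants depend on `f`, `B`, `M` only and are chosen before
`W`, which makes them uniform in time. -/
theorem exists_quadraticBound_comp {f : ℝ → ℝ} (hf : ContDiff ℝ 2 f) (B M : ℝ) :
    ∃ B' M' : ℝ, ∀ W, QuadraticBound B M W → QuadraticBound B' M' fun x => f (W x) := by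
  obtain ⟨L, hL0, hL⟩ := exists_abs_sub_sub_deriv_mul_le hf B
  obtain ⟨C₀, hC₀⟩ := isCompact_Icc.exists_bound_of_continuousOn (s := Icc (-B) B)
    hf.continuous.continuousOn
  obtain ⟨C₁, hC₁⟩ := isCompact_Icc.exists_bound_of_continuousOn (s := Icc (-B) B)
    (hf.continuous_deriv one_le_two).continuousOn
  refine ⟨C₀, C₁ * M + L * (2 * B + 2 * M) ^ 2, fun W hW => ?_⟩
  obtain ⟨D, hD⟩ := hW.quadratic
  have hB := hW.bound_nonneg
  have hM := hW.coeff_nonneg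
  have hmem : ∀ x, W x ∈ Icc (-B) B := fun x => abs_le.1 (hW.bound x)
  -- A unit step in the Taylor bound controls the slope by the oscillation of `W`.
  have hD' : ∀ y, |D y| ≤ 2 * B + M := fun y => by
    have h1 := abs_le.1 (hD y (y + 1))
    have h2 := hmem y
    have h3 := hmem (y + 1)
    rw [add_sub_cancel_left] at h1
    rw [abs_le]
    constructor <;> linarith [h1.1, h1.2, h2.1, h2.2, h3.1, h3.2]
  have hlip : ∀ y z, |W z - W y| ≤ (2 * B + 2 * M) * |z - y| := fun y z => by
    rcases le_or_gt 1 |z - y| with h | h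
    · have h2 := hmem y
      have h3 := hmem z
      have : |W z - W y| ≤ 2 * B := by
        rw [abs_le]; constructor <;> linarith [h2.1, h2.2, h3.1, h3.2]
      nlinarith
    · have h1 := abs_sub_abs_le_abs_sub (W z - W y) (D y * (z - y))
      have h2 := hD y z
      rw [abs_mul] at h1
      have h3 := mul_le_mul_of_nonneg_right (hD' y) (abs_nonneg (z - y))
      have h4 : M * (z - y) ^ 2 ≤ M * |z - y| := by
        rw [← sq_abs]; gcongr; nlinarith [abs_nonneg (z - y)]
      nlinarith
  refine ⟨hf.continuous.comp hW.continuous, fun x => hC₀ _ (hmem x),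
    fun y => deriv f (W y) * D y, fun y z => ?_⟩
  have e : f (W z) - f (W y) - deriv f (W y) * D y * (z - y) =
      (f (W z) - f (W y) - deriv f (W y) * (W z - W y))
        + deriv f (W y) * (W z - W y - D y * (z - y)) := by ring
  rw [e]
  have hC₁0 : 0 ≤ C₁ := (norm_nonneg _).trans (hC₁ _ (hmem 0))
  calc _ ≤ |f (W z) - f (W y) - deriv f (W y) * (W z - W y)|
        + |deriv f (W y)| * |W z - W y - D y * (z - y)| := by
        rw [← abs_mul]; exact abs_add_le _ _
    _ ≤ L * (W z - W y) ^ 2 + C₁ * (M * (z - y) ^ 2) := by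
        gcongr
        · exact hL _ (hmem y) _ (hmem z)
        · exact hC₁ _ (hmem y)
        · exact hD y z
    _ ≤ L * ((2 * B + 2 * M) ^ 2 * (z - y) ^ 2) + C₁ * (M * (z - y) ^ 2) := by
        gcongr
        rw [← sq_abs, ← sq_abs (z - y), ← mul_pow]
        gcongr
        exact hlip y z
    _ = _ := by ring

/-- The total variation of a signed measure, as the sum of its Jordan parts. -/
noncomputable def jordanSum (μ : SignedMeasure ℝ) : Measure ℝ :=
  μ.toJordanDecomposition.posPart + μ.toJordanDecomposition.negPart

instance (μ : SignedMeasure ℝ) : IsFiniteMeasure (jordanSum μ) := by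
  unfold jordanSum; infer_instance

/-! ### Discrete kernels of `α'`, and the pointwise form of the equation -/

section kernel

variable {α : ℝ → ℝ} {μ : SignedMeasure ℝ}

theorem integral_jordanSum (μ : SignedMeasure ℝ) {t : ℝ} (ht : 0 ≤ t) (x : ℝ) :
    ∫ y, hat t (y - x) ∂jordanSum μ = (∫ y, hat t (y - x) ∂μ.toJordanDecomposition.posPart)
      + ∫ y, hat t (y - x) ∂μ.toJordanDecomposition.negPart :=
  integral_add_measure (integrable_hat_sub _ ht x) (integrable_hat_sub _ ht x)

theorem abs_integral_hat_sub_integral_hat_le (μ : SignedMeasure ℝ) {t : ℝ} (ht : 0 ≤ t) (x : ℝ) :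
    |(∫ y, hat t (y - x) ∂μ.toJordanDecomposition.posPart)
      - ∫ y, hat t (y - x) ∂μ.toJordanDecomposition.negPart| ≤
      ∫ y, hat t (y - x) ∂jordanSum μ := by
  rw [integral_jordanSum μ ht]
  have h1 : 0 ≤ ∫ y, hat t (y - x) ∂μ.toJordanDecomposition.posPart :=
    integral_nonneg fun y => hat_nonneg _ _
  have h2 : 0 ≤ ∫ y, hat t (y - x) ∂μ.toJordanDecomposition.negPart :=
    integral_nonneg fun y => hat_nonneg _ _
  rw [abs_le]; constructor <;> linarith

theorem IsThirdDerivMeasure.secondDiffBound (hμ : IsThirdDerivMeasure α μ) (hα : MemW 2 1 α) :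
    SecondDiffBound (kernelDeriv α) (jordanSum μ) := fun x t ht => by
  rw [hμ.secondDiff_kernelDeriv hα x ht]
  exact abs_integral_hat_sub_integral_hat_le μ ht x

theorem IsThirdDerivMeasure.mul_secondDiff_eq (hμ : IsThirdDerivMeasure α μ) (hα : MemW 2 1 α)
    {h : ℝ} (hh : 0 < h) (k : ℤ) :
    h * secondDiff h (gridRestrict h (kernelDeriv α)) k =
      1 / h * ((∫ y, hat h (y - k * h) ∂μ.toJordanDecomposition.posPart)
        - ∫ y, hat h (y - k * h) ∂μ.toJordanDecomposition.negPart) := by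
  rw [← hμ.secondDiff_kernelDeriv hα _ hh.le]
  simp only [secondDiff, gridRestrict]
  push_cast
  rw [add_one_mul, sub_one_mul]
  field_simp

theorem IsThirdDerivMeasure.abs_mul_secondDiff_le (hμ : IsThirdDerivMeasure α μ)
    (hα : MemW 2 1 α) {h : ℝ} (hh : 0 < h) (k : ℤ) :
    |h * secondDiff h (gridRestrict h (kernelDeriv α)) k| ≤
      1 / h * ∫ y, hat h (y - k * h) ∂jordanSum μ := by
  rw [hμ.mul_secondDiff_eq hα hh, abs_mul, abs_of_pos (one_div_pos.2 hh)]
  gcongr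
  exact abs_integral_hat_sub_integral_hat_le μ hh.le _

theorem IsThirdDerivMeasure.summable_secondDiff (hμ : IsThirdDerivMeasure α μ)
    (hα : MemW 2 1 α) {h : ℝ} (hh : 0 < h) :
    Summable fun k : ℤ => |h * secondDiff h (gridRestrict h (kernelDeriv α)) k| :=
  Summable.of_nonneg_of_le (fun _ => abs_nonneg _) (hμ.abs_mul_secondDiff_le hα hh)
    ((summable_integral_hat hh).mul_left _)

/-- The factor `1/h` from the hat formula cancels the `h` to which the hats sum, so the `ℓ¹` norm
stays bounded as `h → 0` despite the division by `h²`. -/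
theorem IsThirdDerivMeasure.tsum_secondDiff_le (hμ : IsThirdDerivMeasure α μ)
    (hα : MemW 2 1 α) {h : ℝ} (hh : 0 < h) :
    ∑' k : ℤ, |h * secondDiff h (gridRestrict h (kernelDeriv α)) k| ≤ (jordanSum μ).real univ := by
  have hs := (summable_integral_hat (m := jordanSum μ) hh).mul_left (1 / h)
  refine ((hμ.summable_secondDiff hα hh).tsum_le_tsum (hμ.abs_mul_secondDiff_le hα hh) hs).trans ?_
  rw [tsum_mul_left]
  calc _ ≤ 1 / h * (h * (jordanSum μ).real univ) := by gcongr; exact tsum_integral_hat_le hh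
    _ = _ := by field_simp

theorem integral_signedMeasure_eq_of_quadraticBound (μ : SignedMeasure ℝ) {B M : ℝ} {W : ℝ → ℝ}
    (hW : QuadraticBound B M W) :
    ∫ᵛ y, W y ∂•μ = (∫ y, W y ∂μ.toJordanDecomposition.posPart)
      - ∫ y, W y ∂μ.toJordanDecomposition.negPart :=
  have hi : ∀ (m : Measure ℝ) [IsFiniteMeasure m], Integrable W m := fun _ _ =>
    (integrable_const B).mono' hW.continuous.aestronglyMeasurable (.of_forall hW.bound)
  integral_signedMeasure_eq μ (hi _) (hi _)

/-- Consistency of the discrete convolution with the second difference of the kernel. -/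
theorem IsThirdDerivMeasure.abs_tsum_secondDiff_sub_le (hμ : IsThirdDerivMeasure α μ)
    (hα : MemW 2 1 α) {B M : ℝ} {W : ℝ → ℝ} (hW : QuadraticBound B M W) {h : ℝ} (hh : 0 < h) :
    |∑' k : ℤ, h * secondDiff h (gridRestrict h (kernelDeriv α)) k * W (k * h) - ∫ᵛ y, W y ∂•μ|
      ≤ M * (jordanSum μ).real univ * h ^ 2 := by
  set p := μ.toJordanDecomposition.posPart
  set n := μ.toJordanDecomposition.negPart
  have hp := hW.abs_tsum_integral_hat_sub_le (integrable_const (μ := p) (1 : ℝ)) hh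
  have hn := hW.abs_tsum_integral_hat_sub_le (integrable_const (μ := n) (1 : ℝ)) hh
  have sp := (hasSum_integral_hat_mul (integrable_const (μ := p) (1 : ℝ)) hh
    fun k : ℤ => hW.bound (k * h)).summable
  have sn := (hasSum_integral_hat_mul (integrable_const (μ := n) (1 : ℝ)) hh
    fun k : ℤ => hW.bound (k * h)).summable
  simp only [mul_one, abs_one, integral_const, smul_eq_mul] at hp hn sp sn
  have hm : (jordanSum μ).real univ = p.real univ + n.real univ := by
    rw [jordanSum, measureReal_add_apply]
  -- By the hat formula the discrete sum is exactly `1/h` times the sum for the positive part minus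
  -- that for the negative part; only interpolation errors `O(h³)` remain.
  have e1 : ∑' k : ℤ, h * secondDiff h (gridRestrict h (kernelDeriv α)) k * W (k * h) =
      1 / h * (∑' k : ℤ, (∫ y, hat h (y - k * h) ∂p) * W (k * h)
        - ∑' k : ℤ, (∫ y, hat h (y - k * h) ∂n) * W (k * h)) := by
    rw [← sp.tsum_sub sn, ← tsum_mul_left]
    congr 1; ext k
    rw [hμ.mul_secondDiff_eq hα hh]; ring
  rw [e1, integral_signedMeasure_eq_of_quadraticBound μ hW, hm]
  set Sp := ∑' k : ℤ, (∫ y, hat h (y - k * h) ∂p) * W (k * h)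
  set Sn := ∑' k : ℤ, (∫ y, hat h (y - k * h) ∂n) * W (k * h)
  have e2 : 1 / h * (Sp - Sn) - ((∫ y, W y ∂p) - ∫ y, W y ∂n) =
      1 / h * ((Sp - h * ∫ y, W y ∂p) - (Sn - h * ∫ y, W y ∂n)) := by field_simp; ring
  rw [e2, abs_mul, abs_of_pos (one_div_pos.2 hh)]
  calc _ ≤ 1 / h * (h ^ 3 * M * p.real univ + h ^ 3 * M * n.real univ) := by
        gcongr; exact (abs_sub _ _).trans (add_le_add hp hn)
    _ = _ := by field_simp

theorem continuous_integral_comp_sub {a w : ℝ → ℝ} {m : Measure ℝ} (ha : Integrable a m)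
    (hw : Continuous w) {B : ℝ} (hB : ∀ x, |w x| ≤ B) :
    Continuous fun x => ∫ y, w (x - y) * a y ∂m := by
  refine continuous_of_dominated (bound := fun y => B * |a y|)
    (fun x => (hw.comp (by fun_prop)).aestronglyMeasurable.mul ha.aestronglyMeasurable)
    (fun x => .of_forall fun y => ?_) (ha.abs.const_mul B)
    (.of_forall fun y => (hw.comp (by fun_prop)).mul continuous_const)
  rw [Real.norm_eq_abs, abs_mul]
  gcongr
  exact hB _

theorem integral_kernel_mul_eq (a w : ℝ → ℝ) (x : ℝ) :
    ∫ y, a (x - y) * w y = ∫ y, w (x - y) * a y := by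
  rw [← integral_sub_left_eq_self _ volume x]
  congr 1; ext y
  rw [sub_sub_cancel, mul_comm]

/-- The equation holds at every point. -/
theorem IsCauchySolution.equation_everywhere {f : ℝ → ℝ} {κ s T : ℝ} {φ : Sobolev s}
    {u : ℝ → Sobolev s} (hu : IsCauchySolution α μ f κ φ T u) (hα : MemW 2 1 α) (hs : 5 / 2 < s)
    (hf : ContDiff ℝ 2 f) {t : ℝ} (ht : t ∈ Icc 0 T) (x : ℝ) :
    (derivWithin u (Icc 0 T) t).fn x =
      -(∫ y, f ((u t).fn (x - y)) * kernelDeriv α y) - κ * ∫ᵛ y, (u t).fn (x - y) ∂•μ := by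
  obtain ⟨C, -, hC⟩ := Sobolev.exists_quadraticBound hs
  have hW := (hC (u t)).1
  obtain ⟨B', M', hcomp⟩ := exists_quadraticBound_comp hf (C * ‖u t‖) (C * ‖u t‖)
  have hfW := hcomp _ hW
  have hα' := kernelDeriv_spec hα
  have c1 : Continuous fun x => ∫ y, f ((u t).fn (x - y)) * kernelDeriv α y :=
    continuous_integral_comp_sub hα'.2.1 hfW.continuous hfW.bound
  have c2 : Continuous fun x => ∫ᵛ y, (u t).fn (x - y) ∂•μ := by
    simp_rw [fun x => integral_signedMeasure_eq_of_quadraticBound μ (hW.comp_sub_left x)]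
    have hc : ∀ (m : Measure ℝ) [IsFiniteMeasure m],
        Continuous fun x => ∫ y, (u t).fn (x - y) ∂m := fun m _ => by
      simpa using continuous_integral_comp_sub (integrable_const (μ := m) (1 : ℝ))
        hW.continuous hW.bound
    exact (hc _).sub (hc _)
  have key : (derivWithin u (Icc 0 T) t).fn = fun x =>
      -(∫ y, f ((u t).fn (x - y)) * kernelDeriv α y) - κ * ∫ᵛ y, (u t).fn (x - y) ∂•μ := by
    -- Both sides are continuous, so equality almost everywhere is equality everywhere, grid points
    -- included.
    refine (((hC _).1.continuous).ae_eq_iff_eq volume (c1.neg.sub (continuous_const.mul c2))).1 ?_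
    filter_upwards [hu.equation t ht] with x hx
    rw [integral_kernel_mul_eq (kernelDeriv α) (fun y => f ((u t).fn y))] at hx
    simp only [Pi.sub_apply, Pi.neg_apply, Pi.mul_apply]
    linarith
  exact congrFun key x

end kernel

/-! ### Restriction of Sobolev functions to the grid -/

/-- Restriction to the grid, as a bounded operator on `H^s(ℝ)`. -/
noncomputable def restrictCLM {s : ℝ} (hs : 5 / 2 < s) (h : ℝ) : Sobolev s →L[ℝ] GridSpace :=
  LinearMap.mkContinuous
    { toFun := fun g => ⟨gridRestrict h g.fn, memℓp_infty_of_forall fun _ =>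
        ((Sobolev.exists_quadraticBound hs).choose_spec.2 g).1.bound _⟩
      map_add' := fun g k => lp.ext (by
        simp only [Sobolev.fn_add hs, lp.coeFn_add]; rfl)
      map_smul' := fun c g => lp.ext (by
        simp only [Sobolev.fn_smul hs, lp.coeFn_smul]; rfl) }
    (Sobolev.exists_quadraticBound hs).choose fun g =>
      GridSpace.norm_le (mul_nonneg (Sobolev.exists_quadraticBound hs).choose_spec.1 (norm_nonneg _))
        fun _ => ((Sobolev.exists_quadraticBound hs).choose_spec.2 g).1.bound _

theorem restrictCLM_apply {s : ℝ} (hs : 5 / 2 < s) (h : ℝ) (g : Sobolev s) (i : ℤ) :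
    restrictCLM hs h g i = g.fn (i * h) := rfl

/-- Reindexing by `j ↦ i - j` moves the shift onto the smooth factor, so the quadrature estimates
apply to `y ↦ w (i * h - y)`. -/
theorem tsum_grid_conv_eq (k : ℤ → ℝ) (w : ℝ → ℝ) (h : ℝ) (i : ℤ) :
    ∑' j : ℤ, k (i - j) * w (j * h) = ∑' j : ℤ, k j * w (i * h - j * h) := by
  rw [← (Equiv.subLeft i).tsum_eq]
  congr 1; ext j
  simp only [Equiv.subLeft_apply, sub_sub_cancel]
  push_cast
  rw [sub_mul]

/-- The exact solution satisfies the semi-discrete problem up to an error `O(h²)`. -/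
theorem IsCauchySolution.exists_consistency {α f : ℝ → ℝ} {μ : SignedMeasure ℝ} {κ s T : ℝ}
    {φ : Sobolev s} {u : ℝ → Sobolev s} (hu : IsCauchySolution α μ f κ φ T u)
    (hμ : IsThirdDerivMeasure α μ) (hα : MemW 2 1 α) (hs : 5 / 2 < s) (hf : ContDiff ℝ 2 f)
    (hκ : 0 ≤ κ) {B M : ℝ} (hB : ∀ t ∈ Icc 0 T, QuadraticBound B M (u t).fn) :
    ∃ C : ℝ, 0 ≤ C ∧ ∀ {h : ℝ}, 0 < h → ∀ (h₁ : Summable fun i : ℤ =>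
        |h * gridRestrict h (kernelDeriv α) i|)
      (h₂ : Summable fun i : ℤ => |h * secondDiff h (gridRestrict h (kernelDeriv α)) i|),
      ∀ t ∈ Icc 0 T, ‖restrictCLM hs h (derivWithin u (Icc 0 T) t)
        - gridField κ hf.continuous h₁ h₂ (restrictCLM hs h (u t))‖ ≤ C * h ^ 2 := by
  obtain ⟨B', M', hcomp⟩ := exists_quadraticBound_comp hf B M
  set A := M' * (∫ y, |kernelDeriv α y|) + B' / 2 * (jordanSum μ).real univ with hA
  set A' := κ * (M * (jordanSum μ).real univ) with hA'
  have hb : ∀ {h : ℝ}, 0 < h → ∀ (h₁ : Summable fun i : ℤ =>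
        |h * gridRestrict h (kernelDeriv α) i|)
      (h₂ : Summable fun i : ℤ => |h * secondDiff h (gridRestrict h (kernelDeriv α)) i|),
      ∀ t ∈ Icc 0 T, ∀ i : ℤ, |(restrictCLM hs h (derivWithin u (Icc 0 T) t)
        - gridField κ hf.continuous h₁ h₂ (restrictCLM hs h (u t))) i| ≤ (A + A') * h ^ 2 := by
    intro h hh h₁ h₂ t ht i
    have hW := (hB t ht).comp_sub_left (i * h)
    have hfW := (hcomp _ (hB t ht)).comp_sub_left (i * h)
    have t1 := (hμ.secondDiffBound hα).abs_trapezoid_le (kernelDeriv_spec hα).2.1 hfW hh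
    have t2 := hμ.abs_tsum_secondDiff_sub_le hα hW hh
    simp only [lp.coeFn_sub, Pi.sub_apply, gridField_apply, restrictCLM_apply]
    rw [hu.equation_everywhere hα hs hf ht,
      tsum_grid_conv_eq (fun j => h * gridRestrict h (kernelDeriv α) j) (fun y => f ((u t).fn y)),
      tsum_grid_conv_eq (fun j => h * secondDiff h (gridRestrict h (kernelDeriv α)) j)]
    change |∑' k : ℤ, h * gridRestrict h (kernelDeriv α) k * f ((u t).fn (i * h - k * h))
      - ∫ y, f ((u t).fn (i * h - y)) * kernelDeriv α y| ≤ _ at t1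
    set S₁ := ∑' k : ℤ, h * gridRestrict h (kernelDeriv α) k * f ((u t).fn (i * h - k * h))
    set S₂ := ∑' k : ℤ, h * secondDiff h (gridRestrict h (kernelDeriv α)) k
      * (u t).fn (i * h - k * h)
    set I₁ := ∫ y, f ((u t).fn (i * h - y)) * kernelDeriv α y
    set I₂ := ∫ᵛ y, (u t).fn (i * h - y) ∂•μ
    rw [show -I₁ - κ * I₂ - (-S₁ - κ * S₂) = (S₁ - I₁) + κ * (S₂ - I₂) by ring]
    calc _ ≤ |S₁ - I₁| + κ * |S₂ - I₂| := by
          rw [← abs_of_nonneg hκ, ← abs_mul, abs_of_nonneg hκ]; exact abs_add_le _ _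
      _ ≤ A * h ^ 2 + κ * (M * (jordanSum μ).real univ * h ^ 2) := by gcongr
      _ = _ := by rw [hA']; ring
  -- The maximum supplies nonnegativity, as no signs of `B'` and `M'` are recorded.
  refine ⟨max (A + A') 0, le_max_right _ _, fun {h} hh h₁ h₂ t ht =>
    GridSpace.norm_le (by positivity) fun i => (hb hh h₁ h₂ t ht i).trans ?_⟩
  gcongr
  exact le_max_left _ _

theorem exists_lipschitzOnWith_Icc {f : ℝ → ℝ} (hf : ContDiff ℝ 1 f) (R : ℝ) :
    ∃ L, LipschitzOnWith L f (Icc (-R) R) :=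
  hf.contDiffOn.exists_lipschitzOnWith one_ne_zero (convex_Icc (-R) R) isCompact_Icc

end NonlocalKdV

/-! ### Existence up to time `T` and second-order convergence -/

open NonlocalKdV

theorem theorem3p3 (α : ℝ → ℝ) (μ : SignedMeasure ℝ)
    (hC1 : NonlocalKdV.MemW 2 1 α) (hC2 : NonlocalKdV.IsThirdDerivMeasure α μ)
    (κ : ℝ) (hκ : 0 < κ) (s : ℝ) (hs : 9 / 2 < s)
    (f : ℝ → ℝ) (hf : ContDiff ℝ ((⌊s⌋₊ + 1 : ℕ) : WithTop ℕ∞) f) (hf0 : f 0 = 0)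
    (T : ℝ) (hT : 0 < T) (φ : NonlocalKdV.Sobolev s) (u : ℝ → NonlocalKdV.Sobolev s)
    (hu : NonlocalKdV.IsCauchySolution α μ f κ φ T u) :
    ∃ h₀ : ℝ, 0 < h₀ ∧ ∃ C : ℝ, ∀ h : ℝ, 0 < h → h ≤ h₀ →
      (∃ (Th : EReal) (v : ℝ → lp (fun _ : ℤ => ℝ) ∞),
        NonlocalKdV.IsMaximalSemidiscreteSolution α f κ h
          (NonlocalKdV.gridRestrict h φ.fn) Th v) ∧
      ∀ (Th : EReal) (v : ℝ → lp (fun _ : ℤ => ℝ) ∞),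
        NonlocalKdV.IsMaximalSemidiscreteSolution α f κ h
          (NonlocalKdV.gridRestrict h φ.fn) Th v →
        (T : EReal) < Th ∧
          ∀ t ∈ Icc 0 T, ∀ i : ℤ,
            |NonlocalKdV.gridRestrict h (u t).fn i - v t i| ≤ C * h ^ 2 := by
  have hs' : 5 / 2 < s := by linarith
  have hf2 : ContDiff ℝ 2 f := hf.of_le (by
    have : 4 ≤ ⌊s⌋₊ := Nat.le_floor (by push_cast; linarith)
    exact_mod_cast (by omega : 2 ≤ ⌊s⌋₊ + 1))
  have hf1 : ContDiff ℝ 1 f := hf2.of_le one_le_two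
  obtain ⟨C₀, hC₀, hemb⟩ := Sobolev.exists_quadraticBound hs'
  obtain ⟨N, hN⟩ := isCompact_Icc.exists_bound_of_continuousOn hu.contDiffOn.continuousOn
  have hN0 : 0 ≤ N := (norm_nonneg _).trans (hN 0 ⟨le_rfl, hT.le⟩)
  have hB : ∀ t ∈ Icc 0 T, QuadraticBound (C₀ * N) (C₀ * N) (u t).fn := fun t ht =>
    (hemb (u t)).1.mono (by gcongr; exact hN t ht) (by gcongr; exact hN t ht)
  obtain ⟨E, hE0, hE⟩ := hu.exists_consistency hC2 hC1 hs' hf2 hκ.le hB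
  -- `C₀ * N` bounds `u` on `[0,T]`; the extra 1 is the room required by the truncation argument.
  set R := C₀ * N + 1 with hR
  have hR0 : 0 ≤ R := by positivity
  obtain ⟨L, hL⟩ := exists_lipschitzOnWith_Icc hf1 R
  set m := (jordanSum μ).real univ with hm
  -- The Lipschitz constant on the ball of radius `R`, from the uniform `ℓ¹` bounds; `m / 2` absorbs
  -- `h²/2 * m` for `h ≤ 1`.
  set K : NNReal := (((∫ y, |kernelDeriv α y|) + m / 2) * L + κ * m).toNNReal with hK
  set g := gronwallBound 0 K 1 T with hg
  have hg0 : 0 ≤ g := gronwallBound_nonneg K.2 zero_le_one hT.le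
  -- For `h ≤ 1`, `g * E * h ^ 2 ≤ g * E * h ≤ 1/2`, the Gronwall margin; the `+ 1` keeps the
  -- denominator positive.
  refine ⟨min 1 (1 / (2 * (g * E + 1))), by positivity, g * E, fun h hh hh₀ => ?_⟩
  have hh1 : h ≤ 1 := hh₀.trans (min_le_left _ _)
  have hhE : g * (E * h ^ 2) ≤ 1 / 2 := by
    have h1 := hh₀.trans (min_le_right _ _)
    rw [le_div_iff₀ (by positivity)] at h1
    have h2 : h ^ 2 ≤ h := by nlinarith
    nlinarith [mul_le_mul_of_nonneg_left h2 (mul_nonneg hg0 hE0)]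
  have h₁ : Summable fun i : ℤ => |h * gridRestrict h (kernelDeriv α) i| :=
    (hC2.secondDiffBound hC1).summable_grid (kernelDeriv_spec hC1).2.1 hh
  have h₂ := hC2.summable_secondDiff hC1 hh
  have hA₁ : ∑' i : ℤ, |h * gridRestrict h (kernelDeriv α) i| ≤
      (∫ y, |kernelDeriv α y|) + m / 2 := by
    refine ((hC2.secondDiffBound hC1).tsum_grid_le (kernelDeriv_spec hC1).2.1 hh).trans ?_
    have hm0 : 0 ≤ m := measureReal_nonneg
    have : h ^ 2 ≤ 1 := by nlinarith
    nlinarith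
  have hA₂ := hC2.tsum_secondDiff_le hC1 hh
  set G := gridField κ hf2.continuous h₁ h₂ with hG
  have hloc : ∀ R : ℝ, ∃ K, LipschitzOnWith K G (Metric.closedBall 0 R) := fun R => by
    obtain ⟨L, hL⟩ := exists_lipschitzOnWith_Icc hf1 R
    exact ⟨_, lipschitzOnWith_gridField hκ.le _ h₁ h₂ hL le_rfl le_rfl⟩
  have hud : ∀ t ∈ Icc 0 T, HasDerivWithinAt (fun t => restrictCLM hs' h (u t))
      (restrictCLM hs' h (derivWithin u (Icc 0 T) t)) (Icc 0 T) t := fun t ht =>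
    (restrictCLM hs' h).hasFDerivAt.comp_hasDerivWithinAt t
      (hu.contDiffOn.differentiableOn one_ne_zero t ht).hasDerivWithinAt
  obtain ⟨S, hTS, w, hw, hwu⟩ := exists_solvesODE_of_approx hR0
    (lipschitzOnWith_gridField hκ.le hf2.continuous h₁ h₂ hL hA₁ hA₂) (lipschitzWith_truncate R)
    (truncate_mem hR0) (fun _ => truncate_eq_self) hT hud (hE hh h₁ h₂)
    (fun t ht => by
      rw [hR, add_sub_cancel_right]
      exact GridSpace.norm_le (by positivity) fun i => (hB t ht).bound _)
    (by rw [gronwallBound_zero_eq_mul]; exact hhE)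
  simp only [gronwallBound_zero_eq_mul _ (E * h ^ 2)] at hwu
  set x₀ : GridSpace := restrictCLM hs' h (u 0) with hx₀
  have hx₀φ : (x₀ : ℤ → ℝ) = gridRestrict h φ.fn := by
    rw [hx₀, hu.initial]; rfl
  rw [← hx₀φ]
  have hiff := isSemidiscreteSolution_iff (κ := κ) hf2.continuous h₁ h₂ hloc x₀
  have hS : 0 < S := (EReal.coe_pos.2 hT).trans hTS
  refine ⟨?_, fun Th v hv => ?_⟩
  · obtain ⟨S', v, hS', hv, hmax⟩ := SolvesODE.exists_maximal hloc hS hw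
    exact ⟨S', v, hS', (hiff _ _).2 hv, fun S'' w' hlt hw' _ => hmax S'' w' hlt ((hiff _ _).1 hw')⟩
  · have hv' := (hiff _ _).1 hv.solution
    -- If `Th ≤ T`, then `w`, which lives beyond `T` and agrees with `v` by uniqueness, would extend
    -- `v`, against maximality.
    have hTh : (T : EReal) < Th := by
      by_contra! hle
      exact hv.maximal S w (hle.trans_lt hTS) ((hiff _ _).2 hw) fun t ht =>
        hv'.eq hloc hw ht ⟨ht.1, (ht.2.trans_le hle).trans hTS⟩
    refine ⟨hTh, fun t ht i => ?_⟩
    have htT : (t : EReal) ≤ T := EReal.coe_le_coe_iff.2 ht.2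
    rw [hv'.eq hloc hw ⟨ht.1, htT.trans_lt hTh⟩ ⟨ht.1, htT.trans_lt hTS⟩, abs_sub_comm]
    have := ((w t - restrictCLM hs' h (u t)).abs_apply_le i).trans (hwu t ht)
    rw [← mul_assoc] at this
    exact this
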